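/- Let $d,n\ge 1$ be integers with $s:=d-2n>-2$. Let $K_s(x)=\operatorname{sign}(s)|x|^{-s}$ if $s\ne0$ and $K_0(x)=-\log|x|$ on $\mathbb{R}^d$ (with $K_s(0)=+\infty$ if $s\ge 0$ and $K_s(0)=0$ if $s<0$). Let $V:\mathbb{R}^d\to(-\infty,+\infty]$ be lower semicontinuous with $\inf_{x\ne y}\big(K_s(x-y)+V(x)+V(y)\big)>-\infty$, and for a probability measure $\mu$ on $\mathbb{R}^d$ let $$I(\mu)=\iint\big(K_s(x-y)+V(x)+V(y)\big)\,\mu(dx)\,\mu(dy)\in(-\infty,+\infty].$$ Let $\mu_{\mathrm{eq}}$ be an equilibrium measure, that is, a probability measure that minimizes $I$ over all probability measures on $\mathbb{R}^d$, with $I(\mu_{\mathrm{eq}})<\infty$, and let $\Omega$ be the interior of its (closed) support. Put $$c_2=2\pi,\qquad c_d=|d-2|\,\frac{2\pi^{d/2}}{\Gamma(d/2)}\ \ (d\ne2),\qquad C_{d,n}=(-1)^{n-1}\frac{(d-4)!!\,(2n-2)!!}{(d-2n-2)!!},$$ where $z!!$ is the double factorial for integers $z\geq 1$, and $z!!:=1$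 for integers $z\le 0$. Then: 1. $V$ is almost everywhere finite and locally integrable on $\Omega$, and in the sense of distributions on $\Omega$, $$\mu_{\mathrm{eq}}=\frac{\Delta^nV}{c_d\,C_{d,n}},$$ that is, $\int\varphi\,d\mu_{\mathrm{eq}}=\frac{1}{c_dC_{d,n}}\int V\,\Delta^n\varphi\,dx$ for every $\varphi\in C_c^\infty(\Omega)$. 2. If $n$ is odd, then $C_{d,n}>0$, and if moreover $V$ is (finite and) of class $C^{2n}$ on $\mathbb{R}^d$, then $\Omega\cap\{\Delta^nV<0\}=\varnothing$. 3. If $n$ is even, then $C_{d,n}<0$, and if moreover $V$ is (finite and) of class $C^{2n}$ on $\mathbb{R}^d$, then $\Omega\cap\{\Delta^nV>0\}=\varnothing$. -/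

import Mathlib

open MeasureTheory InnerProductSpace Distributions

noncomputable section

namespace RieszGas

/-- The Riesz `s`-kernel on `ℝ^d` with values in `(-∞, +∞]`: `sign(s) ‖x‖^(-s)` for `s ≠ 0` and
`-log ‖x‖` for `s = 0`, with value `+∞` at the origin when `s ≥ 0` (and `0` there when `s < 0`). -/
def rieszKernel {d : ℕ} (s : ℝ) (x : EuclideanSpace ℝ (Fin d)) : EReal :=
  if 0 ≤ s ∧ x = 0 then ⊤
  else if s = 0 then ((-Real.log ‖x‖ : ℝ) : EReal)
  else ((Real.sign s * ‖x‖ ^ (-s) : ℝ) : EReal)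

/-- The integral of an extended real valued function, as the integral of its positive part minus
the integral of its negative part. It is the usual integral in `(-∞, +∞]` when the function is
bounded below and the measure is finite. -/
def extIntegral {α : Type*} [MeasurableSpace α] (m : Measure α) (f : α → EReal) : EReal :=
  ((∫⁻ a, (f a).toENNReal ∂m : ENNReal) : EReal) - ((∫⁻ a, (-f a).toENNReal ∂m : ENNReal) : EReal)

/-- An admissible external field `V : ℝ^d → (-∞, +∞]` for the kernel of index `s`: it is lower
semicontinuous and `K_s(x-y) + V(x) + V(y)` is bounded below on `x ≠ y`. -/
structure IsExternalField {d : ℕ} (s : ℝ) (V : EuclideanSpace ℝ (Fin d) → EReal) : Prop where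
  ne_bot : ∀ x, V x ≠ ⊥
  lowerSemicontinuous : LowerSemicontinuous V
  bounded_below : ∃ C : ℝ, ∀ x y, x ≠ y → (C : EReal) ≤ rieszKernel s (x - y) + V x + V y

/-- The energy `I(μ) = ∬ (K_s(x-y) + V(x) + V(y)) μ(dx) μ(dy)`. -/
def energy {d : ℕ} (s : ℝ) (V : EuclideanSpace ℝ (Fin d) → EReal)
    (μ : Measure (EuclideanSpace ℝ (Fin d))) : EReal :=
  extIntegral (μ.prod μ) fun p => rieszKernel s (p.1 - p.2) + V p.1 + V p.2

/-- `μ` is an equilibrium measure: a minimizer, of finite energy, of the energy among all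
probability measures. -/
structure IsEquilibriumMeasure {d : ℕ} (s : ℝ) (V : EuclideanSpace ℝ (Fin d) → EReal)
    (μ : Measure (EuclideanSpace ℝ (Fin d))) : Prop where
  isProbabilityMeasure : IsProbabilityMeasure μ
  energy_ne_bot : energy s V μ ≠ ⊥
  energy_ne_top : energy s V μ ≠ ⊤
  energy_le : ∀ ν : Measure (EuclideanSpace ℝ (Fin d)), IsProbabilityMeasure ν →
    energy s V μ ≤ energy s V ν

/-- The interior of the (closed) support of `μ`, as an open set. -/
def suppInterior {d : ℕ} (μ : Measure (EuclideanSpace ℝ (Fin d))) :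
    TopologicalSpace.Opens (EuclideanSpace ℝ (Fin d)) :=
  ⟨interior μ.support, isOpen_interior⟩

/-- The iterated (classical) Laplacian `Δ^n f` of a real function on `ℝ^d`. -/
def iterLaplacian {d : ℕ} (n : ℕ) (f : EuclideanSpace ℝ (Fin d) → ℝ) :
    EuclideanSpace ℝ (Fin d) → ℝ :=
  (fun g : EuclideanSpace ℝ (Fin d) → ℝ => Laplacian.laplacian g)^[n] f

/-- The constant `c_d` with `-Δ K_{d-2} = c_d δ_0` for `d ≥ 1`: `2π` for `d = 2`, and
`|d-2|` times the surface area of the unit sphere otherwise. -/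
def coulombConst (d : ℕ) : ℝ :=
  if d = 2 then 2 * Real.pi
  else |(d : ℝ) - 2| * (2 * Real.pi ^ ((d : ℝ) / 2) / Real.Gamma ((d : ℝ) / 2))

/-- The double factorial of an integer, equal to `1` on nonpositive integers. -/
def intDoubleFactorial (z : ℤ) : ℝ := (Nat.doubleFactorial z.toNat : ℝ)

/-- `C_{d,n} = (-1)^(n-1) (d-4)!! (2n-2)!! / (d-2n-2)!!`, for `n ≥ 1`. -/
def iterCoulombConst (d n : ℕ) : ℝ :=
  (-1) ^ (n - 1) * (intDoubleFactorial ((d : ℤ) - 4) * intDoubleFactorial (2 * (n : ℤ) - 2)) /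
    intDoubleFactorial ((d : ℤ) - 2 * (n : ℤ) - 2)

end RieszGas

end

/-! The proof combines an Euler–Lagrange equation for the minimizer with the fact that `K_{d-2n}`
is, up to a factor, a fundamental solution of `Δ^n`.

Adding a constant to the interaction makes it a nonnegative symmetric kernel `κ`, and minimality
becomes a statement about Lebesgue integrals in `[0, ∞]`. Let `P(x) = ∫ κ(x, y) μ(dy)` and let `E`
be the shifted energy. Comparing `μ` with `(1 - t) μ + t ν` as `t → 0` gives `E ≤ ∫ P dν` for every
probability measure `ν` of finite energy (`energy_le_lintegral_potential`). Normalized restrictions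
of `μ` then give `P = E` `μ`-almost everywhere; Fatou and lower semicontinuity give `P ≤ E` on the
support; normalized restrictions of Lebesgue measure give `P ≥ E` Lebesgue-almost everywhere on `{V
< ∞}`. Hence almost everywhere on the support `V` is a constant minus the Riesz potential of `μ`
(`IsEquilibriumMeasure.exists_external_field_eq`).

For `s ≤ 0` the kernel does not decay, so neither `K_s(x - ·)` nor `V` need be `μ`-integrable
separately. The smooth function `regKernel s 1 y` is therefore subtracted from the kernel and added
to `V y`. This changes the potential only by a constant in `x`, which `Δ^n` kills.

On the kernel side, `K_s` is approximated by the smooth `profile s (‖x‖² + c)`. Green's identity and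
`c → 0` give `Δ K_s = -γ_s (d - s - 2) K_{s+2}` below the Coulomb exponent and `-Δ K_{d-2} = c_d
δ_0` at it; iterating gives `-Δ^n K_{d-2n} = c_d C_{d,n} δ_0`. Fubini then yields the formula for
`μ`. The last two claims hold because `μ ≥ 0` forces the continuous density `Δ^n V / (c_d C_{d,n})`
to be nonnegative on `Ω`. -/

noncomputable section

namespace RieszGas

/-! ### Classical Laplacian: regularity, supports, Green's identity, iterates. -/

section Laplacian

variable {d : ℕ} {f g : EuclideanSpace ℝ (Fin d) → ℝ}

local notation "𝔼" => EuclideanSpace ℝ (Fin d)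

theorem laplacian_eq_sum_fderiv (hf : ContDiff ℝ 2 f) :
    Laplacian.laplacian f = fun x => ∑ i : Fin d,
      fderiv ℝ (fun y => fderiv ℝ f y (EuclideanSpace.basisFun (Fin d) ℝ i)) x
        (EuclideanSpace.basisFun (Fin d) ℝ i) := by
  rw [laplacian_eq_iteratedFDeriv_orthonormalBasis f (EuclideanSpace.basisFun (Fin d) ℝ)]
  funext x
  refine Finset.sum_congr rfl fun i _ => ?_
  have h1 : DifferentiableAt ℝ (fderiv ℝ f) x :=
    (hf.fderiv_right (m := 1) (by norm_num)).differentiable (by norm_num) x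
  rw [iteratedFDeriv_two_apply, fderiv_clm_apply h1 (by fun_prop)]
  simp

theorem contDiff_laplacian {m : ℕ} (hf : ContDiff ℝ (m + 2 : ℕ) f) :
    ContDiff ℝ m (Laplacian.laplacian f) := by
  have h2 : ContDiff ℝ 2 f := hf.of_le (by norm_cast; omega)
  rw [laplacian_eq_sum_fderiv h2]
  refine ContDiff.sum fun i _ => ?_
  have h1 : ContDiff ℝ (m + 1 : ℕ) (fderiv ℝ f) := hf.fderiv_right (by norm_cast)
  have h3 : ContDiff ℝ (m + 1 : ℕ)
      (fun y => fderiv ℝ f y (EuclideanSpace.basisFun (Fin d) ℝ i)) :=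
    h1.clm_apply contDiff_const
  exact (h3.fderiv_right (m := m) (by norm_cast)).clm_apply contDiff_const

theorem contDiff_top_laplacian (hf : ContDiff ℝ (⊤ : ℕ∞) f) :
    ContDiff ℝ (⊤ : ℕ∞) (Laplacian.laplacian f) := by
  rw [contDiff_infty] at hf ⊢
  exact fun m => contDiff_laplacian (hf (m + 2))

theorem support_laplacian_subset (f : 𝔼 → ℝ) :
    Function.support (Laplacian.laplacian f) ⊆ tsupport f := by
  intro x hx
  by_contra hxf
  have h : f =ᶠ[nhds x] fun _ => (0 : ℝ) := notMem_tsupport_iff_eventuallyEq.mp hxf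
  apply hx
  have := (laplacian_congr_nhds h).eq_of_nhds
  rw [this]
  simp

theorem tsupport_laplacian_subset (f : 𝔼 → ℝ) :
    tsupport (Laplacian.laplacian f) ⊆ tsupport f :=
  closure_minimal (support_laplacian_subset f) (isClosed_tsupport f)

theorem hasCompactSupport_laplacian (hf : HasCompactSupport f) :
    HasCompactSupport (Laplacian.laplacian f) :=
  hf.mono' (support_laplacian_subset f)

/-- Green's identity on the whole space, for a compactly supported second factor. -/
theorem integral_mul_laplacian (hf : ContDiff ℝ 2 f) (hg : ContDiff ℝ 2 g)
    (hgc : HasCompactSupport g) :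
    ∫ x, f x * Laplacian.laplacian g x = ∫ x, Laplacian.laplacian f x * g x := by
  rw [laplacian_eq_sum_fderiv hf, laplacian_eq_sum_fderiv hg]
  simp only [Finset.mul_sum, Finset.sum_mul]
  have key : ∀ (v : 𝔼),
      (Continuous fun y => fderiv ℝ f y v) ∧ (Continuous fun y => fderiv ℝ g y v) ∧
      (ContDiff ℝ 1 fun y => fderiv ℝ f y v) ∧ (ContDiff ℝ 1 fun y => fderiv ℝ g y v) ∧
      (HasCompactSupport fun y => fderiv ℝ g y v) ∧
      (HasCompactSupport fun y => fderiv ℝ (fun z => fderiv ℝ g z v) y v) := by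
    intro v
    have a : ContDiff ℝ 1 fun y => fderiv ℝ f y v :=
      (hf.fderiv_right (m := 1) (by norm_num)).clm_apply contDiff_const
    have b : ContDiff ℝ 1 fun y => fderiv ℝ g y v :=
      (hg.fderiv_right (m := 1) (by norm_num)).clm_apply contDiff_const
    have c : HasCompactSupport fun y => fderiv ℝ g y v := hgc.fderiv_apply ℝ v
    exact ⟨a.continuous, b.continuous, a, b, c, c.fderiv_apply ℝ v⟩
  have c1 : ∀ {u : 𝔼 → ℝ} (_ : ContDiff ℝ 1 u) (v : 𝔼), Continuous fun y => fderiv ℝ u y v :=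
    fun hu v => ((hu.continuous_fderiv (by norm_num)).clm_apply continuous_const)
  have cf := hf.continuous
  have cg := hg.continuous
  have i1 : ∀ v : 𝔼, Integrable fun x => f x * fderiv ℝ (fun y => fderiv ℝ g y v) x v := fun v =>
    (cf.mul (c1 (key v).2.2.2.1 v)).integrable_of_hasCompactSupport (key v).2.2.2.2.2.mul_left
  have i2 : ∀ v : 𝔼, Integrable fun x => fderiv ℝ (fun y => fderiv ℝ f y v) x v * g x := fun v =>
    ((c1 (key v).2.2.1 v).mul cg).integrable_of_hasCompactSupport hgc.mul_left
  rw [integral_finsetSum _ fun i _ => i1 _, integral_finsetSum _ fun i _ => i2 _]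
  refine Finset.sum_congr rfl fun i _ => ?_
  set v := EuclideanSpace.basisFun (Fin d) ℝ i
  obtain ⟨k1, k2, k3, k4, k5, k6⟩ := key v
  have i3 : Integrable fun x => fderiv ℝ f x v * fderiv ℝ g x v :=
    (k1.mul k2).integrable_of_hasCompactSupport k5.mul_left
  have e1 := integral_mul_fderiv_eq_neg_fderiv_mul_of_integrable (μ := volume)
    (f := f) (g := fun y => fderiv ℝ g y v) (v := v) i3 (i1 v)
    ((cf.mul k2).integrable_of_hasCompactSupport k5.mul_left)
    (fun x _ => hf.differentiable (by norm_num) x) (fun x _ => k4.differentiable (by norm_num) x)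
  have e2 := integral_mul_fderiv_eq_neg_fderiv_mul_of_integrable (μ := volume)
    (f := fun y => fderiv ℝ f y v) (g := g) (v := v) (i2 v) i3
    ((k1.mul cg).integrable_of_hasCompactSupport hgc.mul_left)
    (fun x _ => k3.differentiable (by norm_num) x) (fun x _ => hg.differentiable (by norm_num) x)
  linarith

/-- Green's identity against the constant `1`. This is what makes additive constants in the
potential disappear. -/
theorem integral_laplacian_eq_zero (hg : ContDiff ℝ 2 g) (hgc : HasCompactSupport g) :
    ∫ x, Laplacian.laplacian g x = 0 := by
  have h := integral_mul_laplacian (f := fun _ => (1 : ℝ)) contDiff_const hg hgc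
  simpa using h

theorem laplacian_comp_add_right (f : 𝔼 → ℝ) (y : 𝔼) :
    Laplacian.laplacian (fun x => f (x + y)) = fun x => Laplacian.laplacian f (x + y) := by
  rw [laplacian_eq_iteratedFDeriv_orthonormalBasis _ (EuclideanSpace.basisFun (Fin d) ℝ),
    laplacian_eq_iteratedFDeriv_orthonormalBasis f (EuclideanSpace.basisFun (Fin d) ℝ)]
  funext x
  simp only [iteratedFDeriv_comp_add_right]

theorem iterLaplacian_zero (f : 𝔼 → ℝ) : iterLaplacian 0 f = f := rfl

theorem iterLaplacian_succ (n : ℕ) (f : 𝔼 → ℝ) :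
    iterLaplacian (n + 1) f = iterLaplacian n (Laplacian.laplacian f) := rfl

theorem iterLaplacian_succ' (n : ℕ) (f : 𝔼 → ℝ) :
    iterLaplacian (n + 1) f = Laplacian.laplacian (iterLaplacian n f) :=
  Function.iterate_succ_apply' _ _ _

theorem contDiff_iterLaplacian {m : ℕ} (n : ℕ) (hf : ContDiff ℝ (2 * n + m : ℕ) f) :
    ContDiff ℝ m (iterLaplacian n f) := by
  induction n generalizing f with
  | zero => simpa [iterLaplacian_zero] using hf
  | succ k ih =>
    rw [iterLaplacian_succ]
    exact ih (contDiff_laplacian (by convert hf using 2; ring))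

theorem contDiff_top_iterLaplacian (n : ℕ) (hf : ContDiff ℝ (⊤ : ℕ∞) f) :
    ContDiff ℝ (⊤ : ℕ∞) (iterLaplacian n f) := by
  induction n with
  | zero => exact hf
  | succ k ih => rw [iterLaplacian_succ']; exact contDiff_top_laplacian ih

theorem tsupport_iterLaplacian_subset (n : ℕ) (f : 𝔼 → ℝ) :
    tsupport (iterLaplacian n f) ⊆ tsupport f := by
  induction n with
  | zero => exact subset_rfl
  | succ k ih => rw [iterLaplacian_succ']; exact (tsupport_laplacian_subset _).trans ih

theorem hasCompactSupport_iterLaplacian (n : ℕ) (hf : HasCompactSupport f) :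
    HasCompactSupport (iterLaplacian n f) :=
  hf.mono' (subset_closure.trans (tsupport_iterLaplacian_subset n f))

theorem iterLaplacian_comp_add_right (n : ℕ) (f : 𝔼 → ℝ) (y : 𝔼) :
    iterLaplacian n (fun x => f (x + y)) = fun x => iterLaplacian n f (x + y) := by
  induction n with
  | zero => rfl
  | succ k ih => rw [iterLaplacian_succ', ih, iterLaplacian_succ', laplacian_comp_add_right]

theorem integral_mul_iterLaplacian (n : ℕ) (hf : ContDiff ℝ (2 * n : ℕ) f)
    (hg : ContDiff ℝ (⊤ : ℕ∞) g) (hgc : HasCompactSupport g) :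
    ∫ x, f x * iterLaplacian n g x = ∫ x, iterLaplacian n f x * g x := by
  induction n generalizing f with
  | zero => rfl
  | succ k ih =>
    have hf2 : ContDiff ℝ (2 * k + 2 : ℕ) f := by convert hf using 2; ring
    rw [iterLaplacian_succ', integral_mul_laplacian (hf.of_le (by norm_cast; omega))
      (contDiff_infty.1 (contDiff_top_iterLaplacian k hg) 2)
      (hasCompactSupport_iterLaplacian k hgc), ih (contDiff_laplacian hf2), iterLaplacian_succ]

end Laplacian

/-! ### Laplacian of radial functions. -/

section Radial

variable {d : ℕ}

local notation "𝔼" => EuclideanSpace ℝ (Fin d)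

/-- The Laplacian of a radial function `x ↦ g (‖x‖² + c)`. -/
theorem laplacian_comp_norm_sq_add {g g' g'' : ℝ → ℝ} {c : ℝ} (hc : 0 < c)
    (h1 : ∀ t, 0 < t → HasDerivAt g (g' t) t) (h2 : ∀ t, 0 < t → HasDerivAt g' (g'' t) t)
    (hg : ContDiff ℝ 2 fun x : 𝔼 => g (‖x‖ ^ 2 + c)) (x : 𝔼) :
    Laplacian.laplacian (fun x : 𝔼 => g (‖x‖ ^ 2 + c)) x =
      2 * d * g' (‖x‖ ^ 2 + c) + 4 * ‖x‖ ^ 2 * g'' (‖x‖ ^ 2 + c) := by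
  have hpos : ∀ y : 𝔼, 0 < ‖y‖ ^ 2 + c := fun y => by positivity
  have hρ : ∀ y : 𝔼, HasFDerivAt (fun z : 𝔼 => ‖z‖ ^ 2 + c) (2 • innerSL ℝ y) y := fun y =>
    (hasStrictFDerivAt_norm_sq y).hasFDerivAt.add_const c
  have hf : ∀ y v : 𝔼, fderiv ℝ (fun x : 𝔼 => g (‖x‖ ^ 2 + c)) y v =
      g' (‖y‖ ^ 2 + c) * (2 * inner ℝ v y) := by
    intro y v
    have := ((h1 _ (hpos y)).comp_hasFDerivAt y (hρ y)).fderiv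
    have e : (fun x : 𝔼 => g (‖x‖ ^ 2 + c)) = g ∘ fun x : 𝔼 => ‖x‖ ^ 2 + c := rfl
    rw [e, this]
    simp [real_inner_comm]
  have hff : ∀ y v : 𝔼, fderiv ℝ (fun z => fderiv ℝ (fun x : 𝔼 => g (‖x‖ ^ 2 + c)) z v) y v =
      g'' (‖y‖ ^ 2 + c) * (2 * inner ℝ v y) ^ 2 + g' (‖y‖ ^ 2 + c) * (2 * inner ℝ v v) := by
    intro y v
    have e : (fun z => fderiv ℝ (fun x : 𝔼 => g (‖x‖ ^ 2 + c)) z v) =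
        fun z => (g' ∘ fun x : 𝔼 => ‖x‖ ^ 2 + c) z * (2 * inner ℝ v z) := by
      funext z; exact hf z v
    rw [e]
    have h3 : HasFDerivAt (fun z : 𝔼 => 2 * inner ℝ v z) ((2 : ℝ) • innerSL ℝ v) y :=
      ((innerSL ℝ v).hasFDerivAt (x := y)).const_mul 2
    have h4 := (((h2 _ (hpos y)).comp_hasFDerivAt y (hρ y)).mul h3).fderiv
    refine (congrArg (fun L => L v) h4).trans ?_
    simp [real_inner_comm]
    ring
  rw [laplacian_eq_sum_fderiv hg]
  simp only [hff]
  rw [Finset.sum_add_distrib]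
  have hs : ∑ i, (inner ℝ (EuclideanSpace.basisFun (Fin d) ℝ i) x) ^ 2 = ‖x‖ ^ 2 := by
    have := (EuclideanSpace.basisFun (Fin d) ℝ).sum_sq_norm_inner_right x
    simpa using this
  have e1 : ∑ i, g'' (‖x‖ ^ 2 + c) * (2 * inner ℝ (EuclideanSpace.basisFun (Fin d) ℝ i) x) ^ 2 =
      4 * ‖x‖ ^ 2 * g'' (‖x‖ ^ 2 + c) := by
    rw [← hs, Finset.mul_sum, Finset.sum_mul]
    exact Finset.sum_congr rfl fun i _ => by ring
  rw [e1]
  simp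
  ring

end Radial

/-! ### The Riesz kernel as a function of the squared distance. -/

section Profile

/-- The function `t ↦ K_s(√t)`. -/
def profile (s t : ℝ) : ℝ :=
  if s = 0 then -(Real.log t) / 2 else Real.sign s * t ^ (-s / 2)

/-- The constant `γ` with `∂_r K_s(r) = -γ r ^ (-s - 1)`. -/
def slope (s : ℝ) : ℝ := if s = 0 then 1 else |s|

theorem slope_pos (s : ℝ) : 0 < slope s := by
  unfold slope
  split_ifs with h
  · exact one_pos
  · exact abs_pos.mpr h

/-- The factor `sign(s)` turns `-s/2` into `-|s|/2`, and the logarithm fits the same formula with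
`slope 0 = 1`. All exponents are thus treated at once, and each kernel decreases with the distance.
-/
theorem hasDerivAt_profile (s : ℝ) {t : ℝ} (ht : 0 < t) :
    HasDerivAt (profile s) (-(slope s / 2) * t ^ (-(s + 2) / 2)) t := by
  have e : -s / 2 - 1 = -(s + 2) / 2 := by ring
  by_cases hs : s = 0
  · have h1 : profile s = fun t => -(Real.log t) / 2 := by
      funext t; simp [profile, hs]
    have h2 : t ^ (-(s + 2) / 2) = t⁻¹ := by
      rw [hs, ← Real.rpow_neg_one]; norm_num
    rw [h1, h2]
    refine (((Real.hasDerivAt_log ht.ne').neg).div_const 2).congr_deriv ?_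
    rw [slope, if_pos hs]; ring
  · have h1 : profile s = fun t => Real.sign s * t ^ (-s / 2) := by
      funext t; simp [profile, hs]
    rw [h1]
    have h2 := (Real.hasDerivAt_rpow_const (p := -s / 2) (Or.inl ht.ne')).const_mul (Real.sign s)
    rw [e, ← mul_assoc] at h2
    have h3 : -(slope s / 2) = Real.sign s * (-s / 2) := by
      have : Real.sign s * s = |s| := by
        rcases lt_trichotomy s 0 with h | h | h
        · simp [Real.sign_of_neg h, abs_of_neg h]
        · exact absurd h hs
        · simp [Real.sign_of_pos h, abs_of_pos h]
      rw [slope, if_neg hs, ← this]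
      ring
    rw [h3]
    exact h2

theorem antitoneOn_profile (s : ℝ) : AntitoneOn (profile s) (Set.Ioi 0) := by
  refine antitoneOn_of_deriv_nonpos (convex_Ioi 0)
    (fun t ht => (hasDerivAt_profile s ht).continuousAt.continuousWithinAt)
    (fun t ht => ?_) (fun t ht => ?_)
  · rw [interior_Ioi] at ht
    exact (hasDerivAt_profile s ht).differentiableAt.differentiableWithinAt
  · rw [interior_Ioi] at ht
    rw [(hasDerivAt_profile s ht).deriv]
    have := slope_pos s
    have := Real.rpow_pos_of_pos (Set.mem_Ioi.mp ht) (-(s + 2) / 2)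
    nlinarith

theorem contDiffAt_profile (s : ℝ) {t : ℝ} (ht : 0 < t) {m : WithTop ℕ∞} :
    ContDiffAt ℝ m (profile s) t := by
  by_cases hs : s = 0
  · have h1 : profile s = fun t => -(Real.log t) / 2 := by
      funext t; simp [profile, hs]
    rw [h1]
    exact ((contDiffAt_id.log ht.ne').neg).div_const 2
  · have h1 : profile s = fun t => Real.sign s * t ^ (-s / 2) := by
      funext t; simp [profile, hs]
    rw [h1]
    exact contDiffAt_const.mul (Real.contDiffAt_rpow_const_of_ne ht.ne')

theorem measurable_profile (s : ℝ) : Measurable (profile s) := by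
  unfold profile
  split_ifs
  · fun_prop
  · fun_prop

theorem profile_of_pos {s : ℝ} (hs : 0 < s) (t : ℝ) : profile s t = t ^ (-s / 2) := by
  simp [profile, hs.ne', Real.sign_of_pos hs]

end Profile

/-! ### Regularized kernels and the fundamental solution of the iterated Laplacian. -/

section RieszKernel

variable {d : ℕ}

local notation "𝔼" => EuclideanSpace ℝ (Fin d)

/-- The regularized kernel `x ↦ K_s(√(‖x‖² + c))`. -/
def regKernel (s c : ℝ) (x : 𝔼) : ℝ := profile s (‖x‖ ^ 2 + c)

/-- The origin causes no exception: `⊤.toReal`, `Real.log 0` and `0 ^ (-s / 2)` with `s ≠ 0` all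
take the value `0`. -/
theorem toReal_rieszKernel (s : ℝ) (x : 𝔼) : (rieszKernel s x).toReal = regKernel s 0 x := by
  unfold rieszKernel regKernel profile
  by_cases h : 0 ≤ s ∧ x = 0
  · rw [if_pos h, h.2]
    by_cases hs : s = 0
    · simp [hs]
    · have : -s / 2 ≠ 0 := by simpa using hs
      simp [hs, Real.zero_rpow this]
  · rw [if_neg h]
    by_cases hs : s = 0
    · simp [hs, Real.log_pow]
      ring
    · rw [if_neg hs, if_neg hs, EReal.toReal_coe, add_zero, ← Real.rpow_natCast,
        ← Real.rpow_mul (norm_nonneg x)]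
      congr 2
      push_cast; ring

theorem rieszKernel_of_ne_zero (s : ℝ) {x : 𝔼} (hx : x ≠ 0) :
    rieszKernel s x = (regKernel s 0 x : ℝ) := by
  rw [← toReal_rieszKernel]
  unfold rieszKernel
  rw [if_neg (by simp [hx])]
  split_ifs <;> simp only [EReal.toReal_coe]

theorem contDiff_regKernel (s : ℝ) {c : ℝ} (hc : 0 < c) {m : WithTop ℕ∞} :
    ContDiff ℝ m (regKernel s c : 𝔼 → ℝ) := by
  rw [contDiff_iff_contDiffAt]
  intro x
  have hpos : 0 < ‖x‖ ^ 2 + c := by positivity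
  exact (contDiffAt_profile s hpos).comp x ((contDiff_norm_sq ℝ).contDiffAt.add contDiffAt_const)

theorem measurable_regKernel (s c : ℝ) : Measurable (regKernel s c : 𝔼 → ℝ) :=
  (measurable_profile s).comp (by fun_prop)

/-- When `s + 2 = d` the `‖x‖ ^ 2` term drops out, and what remains is a multiple of `c (‖x‖² +
c)^(-(d+2)/2)`, an approximate identity as `c → 0`. -/
theorem laplacian_regKernel (s : ℝ) {c : ℝ} (hc : 0 < c) (x : 𝔼) :
    Laplacian.laplacian (regKernel s c : 𝔼 → ℝ) x =
      slope s * (‖x‖ ^ 2 + c) ^ (-(s + 4) / 2) * ((s + 2 - d) * ‖x‖ ^ 2 - d * c) := by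
  have h2 : ∀ t : ℝ, 0 < t → HasDerivAt (fun t => -(slope s / 2) * t ^ (-(s + 2) / 2))
      (-(slope s / 2) * (-(s + 2) / 2 * t ^ (-(s + 4) / 2))) t := by
    intro t ht
    have e : -(s + 4) / 2 = -(s + 2) / 2 - 1 := by ring
    rw [e]
    exact (Real.hasDerivAt_rpow_const (Or.inl ht.ne')).const_mul _
  have hpos : 0 < ‖x‖ ^ 2 + c := by positivity
  have e : (‖x‖ ^ 2 + c) ^ (-(s + 2) / 2) =
      (‖x‖ ^ 2 + c) ^ (-(s + 4) / 2) * (‖x‖ ^ 2 + c) := by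
    rw [← Real.rpow_add_one hpos.ne']; congr 1; ring
  refine (laplacian_comp_norm_sq_add hc (fun t ht => hasDerivAt_profile s ht) h2
    (contDiff_regKernel s hc) x).trans ?_
  rw [e]
  ring

theorem regKernel_anti (s : ℝ) {c c' : ℝ} (hcc : c ≤ c') (x : 𝔼) (hx : 0 < ‖x‖ ^ 2 + c) :
    regKernel s c' x ≤ regKernel s c x :=
  antitoneOn_profile s hx (Set.mem_Ioi.mpr (by linarith)) (by linarith)

theorem ae_ne_zero (hd : 1 ≤ d) : ∀ᵐ x : 𝔼, x ≠ 0 := by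
  have : Nonempty (Fin d) := ⟨⟨0, hd⟩⟩
  have : Nontrivial 𝔼 := by infer_instance
  simp [ae_iff]

theorem integrableOn_ball_regKernel_zero (hd : 1 ≤ d) {s : ℝ} (hs : s < d) (R : ℝ) :
    IntegrableOn (regKernel s 0 : 𝔼 → ℝ) (Metric.ball 0 R) := by
  have : Nonempty (Fin d) := ⟨⟨0, hd⟩⟩
  have : Nontrivial 𝔼 := by infer_instance
  have := (integrableOn_fun_norm_addHaar (volume : Measure 𝔼)
    (f := fun r => profile s (r ^ 2)) (r := R)).mpr
  unfold regKernel
  simp only [add_zero]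
  apply this
  rw [finrank_euclideanSpace, Fintype.card_fin]
  rcases le_or_gt R 0 with hR | hR
  · simp [Set.Ioo_eq_empty (not_lt.mpr hR)]
  rw [← intervalIntegrable_iff_integrableOn_Ioo_of_le hR.le]
  by_cases h0 : s = 0
  · have : IntervalIntegrable (fun r : ℝ => r ^ (d - 1) * -Real.log r) volume 0 R :=
      (intervalIntegral.intervalIntegrable_log').neg.continuousOn_mul (by fun_prop)
    refine this.congr fun r _ => ?_
    simp [profile, h0, Real.log_pow]
    ring
  · have h1 : IntervalIntegrable (fun r : ℝ => Real.sign s * r ^ ((d : ℝ) - 1 - s)) volume 0 R :=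
      (intervalIntegral.intervalIntegrable_rpow' (by linarith)).const_mul _
    rw [intervalIntegrable_iff_integrableOn_Ioo_of_le hR.le] at h1 ⊢
    refine h1.congr_fun (fun r hr => ?_) measurableSet_Ioo
    have hr0 : 0 < r := hr.1
    simp only [profile, if_neg h0, smul_eq_mul]
    rw [← Real.rpow_natCast r 2, ← Real.rpow_mul hr0.le, ← Real.rpow_natCast, Nat.cast_sub hd,
      mul_left_comm, ← Real.rpow_add hr0]
    congr 2
    push_cast; ring

theorem locallyIntegrable_regKernel_zero (hd : 1 ≤ d) {s : ℝ} (hs : s < d) :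
    LocallyIntegrable (regKernel s 0 : 𝔼 → ℝ) := fun x =>
  ⟨Metric.ball 0 (‖x‖ + 1), Metric.isOpen_ball.mem_nhds (by simp),
    integrableOn_ball_regKernel_zero hd hs _⟩

/-- In polar coordinates, `d r^(d-1) (1 + r²)^(-(d+2)/2)` has the primitive `r^d (1 + r²)^(-d/2)`,
which increases from `0` to `1`; the volume of the unit ball is left. This is the mass of the
approximate identity in the Coulomb case. -/
theorem integral_one_add_norm_sq_rpow (hd : 1 ≤ d) :
    ∫ x : 𝔼, (1 + ‖x‖ ^ 2) ^ (-((d : ℝ) + 2) / 2) =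
      Real.pi ^ ((d : ℝ) / 2) / Real.Gamma ((d : ℝ) / 2 + 1) := by
  have : Nonempty (Fin d) := ⟨⟨0, hd⟩⟩
  have : Nontrivial 𝔼 := by infer_instance
  have hd0 : (0 : ℝ) < d := by exact_mod_cast hd
  rw [integral_fun_norm_addHaar (volume : Measure 𝔼)
    (fun r => (1 + r ^ 2) ^ (-((d : ℝ) + 2) / 2)), finrank_euclideanSpace, Fintype.card_fin]
  have hder : ∀ r ∈ Set.Ici (0 : ℝ), HasDerivAt
      (fun r : ℝ => r ^ d * (1 + r ^ 2) ^ (-(d : ℝ) / 2))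
      (d * (r ^ (d - 1) * (1 + r ^ 2) ^ (-((d : ℝ) + 2) / 2))) r := by
    intro r _
    have hpos : 0 < 1 + r ^ 2 := by positivity
    have h1 : HasDerivAt (fun r : ℝ => 1 + r ^ 2) (2 * r) r := by
      simpa using (hasDerivAt_pow 2 r).const_add 1
    have h2 := h1.rpow_const (p := -(d : ℝ) / 2) (Or.inl hpos.ne')
    refine ((hasDerivAt_pow d r).mul h2).congr_deriv ?_
    have e1 : (1 + r ^ 2) ^ (-(d : ℝ) / 2) =
        (1 + r ^ 2) ^ (-((d : ℝ) + 2) / 2) * (1 + r ^ 2) := by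
      rw [← Real.rpow_add_one hpos.ne']; congr 1; ring
    have e2 : -(d : ℝ) / 2 - 1 = -((d : ℝ) + 2) / 2 := by ring
    have e3 : r ^ d = r ^ (d - 1) * r := by rw [← pow_succ]; congr 1; omega
    rw [e1, e2, e3]
    ring
  have hlim : Filter.Tendsto (fun r : ℝ => r ^ d * (1 + r ^ 2) ^ (-(d : ℝ) / 2)) Filter.atTop
      (nhds 1) := by
    have h1 : Filter.Tendsto (fun r : ℝ => (1 + (r ^ 2)⁻¹) ^ (-(d : ℝ) / 2)) Filter.atTop
        (nhds ((1 + 0) ^ (-(d : ℝ) / 2))) := by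
      refine Filter.Tendsto.rpow_const ?_ (Or.inl (by norm_num))
      exact tendsto_const_nhds.add
        (tendsto_inv_atTop_zero.comp (Filter.tendsto_pow_atTop two_ne_zero))
    rw [add_zero, Real.one_rpow] at h1
    refine h1.congr' ?_
    filter_upwards [Filter.eventually_gt_atTop 0] with r hr
    have e1 : 1 + (r ^ 2)⁻¹ = (1 + r ^ 2) * (r ^ 2)⁻¹ := by field_simp; ring
    have e2 : ((r ^ 2)⁻¹) ^ (-(d : ℝ) / 2) = r ^ d := by
      rw [Real.inv_rpow (by positivity), ← Real.rpow_neg (by positivity), ← Real.rpow_natCast r 2,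
        ← Real.rpow_mul hr.le, ← Real.rpow_natCast r d]
      congr 1; push_cast; ring
    rw [e1, Real.mul_rpow (by positivity) (by positivity), e2, mul_comm]
  have hint := integral_Ioi_of_hasDerivAt_of_nonneg' hder
    (fun r hr => by have : 0 < r := hr; positivity) hlim
  rw [integral_const_mul] at hint
  have h0 : (0 : ℝ) ^ d = 0 := zero_pow (by omega)
  simp only [smul_eq_mul, nsmul_eq_mul]
  rw [mul_left_comm, hint, h0, measureReal_def, EuclideanSpace.volume_ball]
  have hG : 0 < Real.Gamma ((d : ℝ) / 2 + 1) := Real.Gamma_pos_of_pos (by positivity)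
  simp only [Fintype.card_fin, ENNReal.ofReal_one, one_pow, one_mul, zero_mul, sub_zero, mul_one]
  rw [ENNReal.toReal_ofReal (by positivity)]
  congr 1
  rw [Real.sqrt_eq_rpow, ← Real.rpow_natCast, ← Real.rpow_mul Real.pi_pos.le]
  congr 1; ring

/-- The regularized kernel is monotone in `c`, so for `0 < c ≤ 1` it lies between its values at `c =
1` and `c = 0`, and both are locally integrable. -/
theorem tendsto_integral_regKernel_mul (hd : 1 ≤ d) {s : ℝ} (hs : s < d) {ψ : 𝔼 → ℝ}
    (hψ : Continuous ψ) (hψc : HasCompactSupport ψ) {c : ℕ → ℝ} (hc : ∀ k, 0 < c k)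
    (hc1 : ∀ k, c k ≤ 1) (hlim : Filter.Tendsto c Filter.atTop (nhds 0)) :
    Filter.Tendsto (fun k => ∫ x : 𝔼, regKernel s (c k) x * ψ x) Filter.atTop
      (nhds (∫ x : 𝔼, regKernel s 0 x * ψ x)) := by
  have i0 : Integrable fun x : 𝔼 => regKernel s 0 x * ψ x :=
    (locallyIntegrable_regKernel_zero hd hs).integrable_smul_right_of_hasCompactSupport hψ hψc
  have i1 : Integrable fun x : 𝔼 => regKernel s 1 x * ψ x :=
    ((contDiff_regKernel s one_pos (m := 0)).continuous.mul hψ).integrable_of_hasCompactSupport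
      hψc.mul_left
  refine tendsto_integral_of_dominated_convergence _
    (fun k => ((measurable_regKernel s (c k)).aestronglyMeasurable.mul hψ.aestronglyMeasurable))
    (i0.norm.add i1.norm) (fun k => ?_) ?_
  · filter_upwards [ae_ne_zero hd] with x hx
    have hx2 : 0 < ‖x‖ ^ 2 := by positivity
    have h1 := regKernel_anti s (hc1 k) x (by have := hc k; positivity)
    have h2 := regKernel_anti s (hc k).le x (by simpa using hx2)
    simp only [Pi.add_apply, norm_mul, Real.norm_eq_abs, ← add_mul]
    refine mul_le_mul_of_nonneg_right ?_ (abs_nonneg _)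
    exact abs_le.mpr ⟨by linarith [neg_abs_le (regKernel s 1 x), abs_nonneg (regKernel s 0 x)],
      by linarith [le_abs_self (regKernel s 0 x), abs_nonneg (regKernel s 1 x)]⟩
  · filter_upwards [ae_ne_zero hd] with x hx
    have hx2 : 0 < ‖x‖ ^ 2 + 0 := by positivity
    exact ((hasDerivAt_profile s hx2).continuousAt.tendsto.comp
      (tendsto_const_nhds.add hlim)).mul_const _

/-- The last factor of the Laplacian is at most a constant times `‖x‖² + c`, which absorbs one power
and leaves `regKernel (s + 2) c ≤ regKernel (s + 2) 0`. Since `s + 2 < d`, this is locally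
integrable, so no mass concentrates at the origin. -/
theorem tendsto_integral_laplacian_regKernel_mul (hd : 1 ≤ d) {s : ℝ} (hs0 : -2 < s)
    (hs : s + 2 < d) {ψ : 𝔼 → ℝ}
    (hψ : Continuous ψ) (hψc : HasCompactSupport ψ) {c : ℕ → ℝ} (hc : ∀ k, 0 < c k)
    (hlim : Filter.Tendsto c Filter.atTop (nhds 0)) :
    Filter.Tendsto (fun k => ∫ x : 𝔼, Laplacian.laplacian (regKernel s (c k) : 𝔼 → ℝ) x * ψ x)
      Filter.atTop
      (nhds (-(slope s * (d - s - 2)) * ∫ x : 𝔼, regKernel (s + 2) 0 x * ψ x)) := by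
  have i0 : Integrable fun x : 𝔼 => regKernel (s + 2) 0 x * ψ x :=
    (locallyIntegrable_regKernel_zero hd hs).integrable_smul_right_of_hasCompactSupport hψ hψc
  rw [← integral_const_mul]
  simp only [laplacian_regKernel s (hc _)]
  refine tendsto_integral_of_dominated_convergence
    (fun x => slope s * (2 * d + |s + 2|) * ‖regKernel (s + 2) 0 x * ψ x‖)
    (fun k => ?_) (i0.norm.const_mul _) (fun k => ?_) ?_
  · exact (Measurable.aestronglyMeasurable (by fun_prop)).mul hψ.aestronglyMeasurable
  · filter_upwards [ae_ne_zero hd] with x hx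
    have hx2 : 0 < ‖x‖ ^ 2 := by positivity
    have hck := hc k
    have hρ : 0 < ‖x‖ ^ 2 + c k := by positivity
    have hsl := slope_pos s
    rw [norm_mul, norm_mul, norm_mul, norm_mul, ← mul_assoc]
    refine mul_le_mul_of_nonneg_right ?_ (norm_nonneg _)
    simp only [Real.norm_eq_abs]
    rw [abs_of_pos hsl, mul_assoc, mul_assoc]
    refine mul_le_mul_of_nonneg_left ?_ hsl.le
    have e : (‖x‖ ^ 2 + c k) ^ (-(s + 4) / 2) * (‖x‖ ^ 2 + c k) =
        regKernel (s + 2) (c k) x := by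
      rw [← Real.rpow_add_one hρ.ne', regKernel, profile_of_pos (by linarith)]; congr 1; ring
    have h1 : regKernel (s + 2) (c k) x ≤ |regKernel (s + 2) 0 x| :=
      (regKernel_anti _ hck.le x (by simpa using hx2)).trans (le_abs_self _)
    have h2 : |(s + 2 - d) * ‖x‖ ^ 2 - d * c k| ≤ (2 * d + |s + 2|) * (‖x‖ ^ 2 + c k) := by
      have a1 := abs_le.mp (le_refl |s + 2|)
      have a2 : (0 : ℝ) ≤ d := by positivity
      have := mul_nonneg a2 hck.le
      have := mul_nonneg a2 hx2.le
      have := mul_nonneg (abs_nonneg (s + 2)) hck.le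
      refine abs_le.mpr ⟨?_, ?_⟩ <;> nlinarith
    have h3 : 0 < (‖x‖ ^ 2 + c k) ^ (-(s + 4) / 2) := Real.rpow_pos_of_pos hρ _
    rw [abs_of_pos h3]
    calc _ ≤ (‖x‖ ^ 2 + c k) ^ (-(s + 4) / 2) * ((2 * d + |s + 2|) * (‖x‖ ^ 2 + c k)) :=
          mul_le_mul_of_nonneg_left h2 h3.le
      _ = (2 * d + |s + 2|) * regKernel (s + 2) (c k) x := by rw [← e]; ring
      _ ≤ _ := mul_le_mul_of_nonneg_left h1 (by positivity)
  · filter_upwards [ae_ne_zero hd] with x hx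
    have hx2 : 0 < ‖x‖ ^ 2 := by positivity
    have l1 : Filter.Tendsto (fun k => ‖x‖ ^ 2 + c k) Filter.atTop (nhds (‖x‖ ^ 2 + 0)) :=
      tendsto_const_nhds.add hlim
    have l2 := l1.rpow_const (p := -(s + 4) / 2) (Or.inl (by positivity))
    have l3 := (((l2.const_mul (slope s)).mul
      ((hlim.const_mul (d : ℝ)).const_sub ((s + 2 - d) * ‖x‖ ^ 2))).mul_const (ψ x))
    convert l3 using 2
    have e : (‖x‖ ^ 2 + 0) ^ (-(s + 4) / 2) * ‖x‖ ^ 2 = regKernel (s + 2) 0 x := by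
      rw [add_zero, ← Real.rpow_add_one hx2.ne', regKernel, profile_of_pos (by linarith), add_zero]
      congr 1; ring
    rw [← e]
    ring

theorem one_div_succ_sq_facts :
    (∀ k : ℕ, (0 : ℝ) < (1 / ((k : ℝ) + 1)) ^ 2) ∧ (∀ k : ℕ, (1 / ((k : ℝ) + 1)) ^ 2 ≤ 1) ∧
    Filter.Tendsto (fun k : ℕ => (1 / ((k : ℝ) + 1)) ^ 2) Filter.atTop (nhds 0) := by
  refine ⟨fun k => by positivity, fun k => ?_, ?_⟩
  · refine pow_le_one₀ (by positivity) ?_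
    rw [div_le_one (by positivity)]
    linarith [k.cast_nonneg (α := ℝ)]
  · simpa using (tendsto_one_div_add_atTop_nhds_zero_nat (𝕜 := ℝ)).pow 2

/-- `Δ K_s = -γ_s (d - s - 2) K_{s+2}` in the sense of distributions, for `-2 < s < d - 2`. -/
theorem integral_regKernel_zero_mul_laplacian (hd : 1 ≤ d) {s : ℝ} (hs0 : -2 < s)
    (hs : s + 2 < d) {ψ : 𝔼 → ℝ} (hψ : ContDiff ℝ 2 ψ) (hψc : HasCompactSupport ψ) :
    ∫ x : 𝔼, regKernel s 0 x * Laplacian.laplacian ψ x =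
      -(slope s * (d - s - 2)) * ∫ x : 𝔼, regKernel (s + 2) 0 x * ψ x := by
  obtain ⟨h1, h2, h3⟩ := one_div_succ_sq_facts
  have l1 := tendsto_integral_regKernel_mul hd (s := s) (by linarith)
    (contDiff_laplacian (m := 0) hψ).continuous (hasCompactSupport_laplacian hψc) h1 h2 h3
  have l2 := tendsto_integral_laplacian_regKernel_mul hd hs0 hs hψ.continuous hψc h1 h3
  -- For each `c > 0` the kernel is smooth, so Green's identity equates the two sequences; their
  -- limits are the two sides.
  refine tendsto_nhds_unique l1 (l2.congr fun k => ?_)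
  exact (integral_mul_laplacian (contDiff_regKernel s (h1 k)) hψ hψc).symm

/-- With `c = ε²` and `x = ε u`, the powers of `ε` cancel exactly: `ε^(-(d+2)) · ε^d · ε² = 1`. The
integral becomes that of a fixed integrable function against `ψ(ε u)`, which tends to `ψ 0`. -/
theorem tendsto_integral_laplacian_regKernel_mul_critical (hd : 1 ≤ d) {s : ℝ}
    (hs : s + 2 = d) {ψ : 𝔼 → ℝ} (hψ : Continuous ψ) (hψc : HasCompactSupport ψ) :
    Filter.Tendsto (fun k : ℕ => ∫ x : 𝔼,
        Laplacian.laplacian (regKernel s ((1 / ((k : ℝ) + 1)) ^ 2) : 𝔼 → ℝ) x * ψ x)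
      Filter.atTop (nhds (-(slope s * d) *
        ((Real.pi ^ ((d : ℝ) / 2) / Real.Gamma ((d : ℝ) / 2 + 1)) * ψ 0))) := by
  obtain ⟨h1, -, -⟩ := one_div_succ_sq_facts
  have hscale : ∀ k : ℕ, ∫ x : 𝔼,
      Laplacian.laplacian (regKernel s ((1 / ((k : ℝ) + 1)) ^ 2) : 𝔼 → ℝ) x * ψ x =
      -(slope s * d) * ∫ u : 𝔼, (1 + ‖u‖ ^ 2) ^ (-((d : ℝ) + 2) / 2) *
        ψ ((1 / ((k : ℝ) + 1)) • u) := by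
    intro k
    set ε : ℝ := 1 / ((k : ℝ) + 1) with hε
    have hε0 : 0 < ε := by positivity
    have := Measure.integral_comp_smul (volume : Measure 𝔼)
      (fun x => Laplacian.laplacian (regKernel s (ε ^ 2) : 𝔼 → ℝ) x * ψ x) ε
    rw [finrank_euclideanSpace, Fintype.card_fin, abs_of_pos (by positivity), smul_eq_mul,
      eq_comm, inv_mul_eq_iff_eq_mul₀ (by positivity)] at this
    rw [this, ← integral_const_mul, ← integral_const_mul]
    congr 1
    funext u
    rw [laplacian_regKernel s (h1 k), norm_smul, Real.norm_of_nonneg hε0.le]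
    have e1 : (ε * ‖u‖) ^ 2 + ε ^ 2 = ε ^ 2 * (1 + ‖u‖ ^ 2) := by ring
    have e2 : -(s + 4) / 2 = -((d : ℝ) + 2) / 2 := by rw [← hs]; ring
    have e3 : (ε ^ 2) ^ (-((d : ℝ) + 2) / 2) * (ε ^ d * ε ^ 2) = 1 := by
      rw [← Real.rpow_natCast ε 2, ← Real.rpow_mul hε0.le, ← Real.rpow_natCast ε d,
        ← Real.rpow_add hε0, ← Real.rpow_add hε0]
      convert Real.rpow_zero ε using 2
      push_cast; ring
    rw [e1, Real.mul_rpow (by positivity) (by positivity), e2, hs]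
    linear_combination (-(slope s * d) * (1 + ‖u‖ ^ 2) ^ (-((d : ℝ) + 2) / 2) * ψ (ε • u)) * e3
  simp only [hscale]
  refine Filter.Tendsto.const_mul _ ?_
  rw [← integral_one_add_norm_sq_rpow hd, ← integral_mul_const]
  obtain ⟨M, hM⟩ := hψ.bounded_above_of_compact_support hψc
  refine tendsto_integral_of_dominated_convergence
    (fun u => (1 + ‖u‖ ^ 2) ^ (-((d : ℝ) + 2) / 2) * M) (fun k => ?_) ?_ (fun k => ?_) ?_
  · exact (Measurable.aestronglyMeasurable (by fun_prop)).mul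
      (hψ.comp (continuous_const_smul _)).aestronglyMeasurable
  · refine (integrable_rpow_neg_one_add_norm_sq ?_).mul_const M
    rw [finrank_euclideanSpace, Fintype.card_fin]; linarith
  · refine ae_of_all _ fun u => ?_
    rw [norm_mul, Real.norm_of_nonneg (by positivity)]
    exact mul_le_mul_of_nonneg_left (hM _) (by positivity)
  · refine ae_of_all _ fun u => Filter.Tendsto.const_mul _ ?_
    have : Filter.Tendsto (fun k : ℕ => (1 / ((k : ℝ) + 1)) • u) Filter.atTop
        (nhds ((0 : ℝ) • u)) :=
      (tendsto_one_div_add_atTop_nhds_zero_nat (𝕜 := ℝ)).smul_const u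
    rw [zero_smul] at this
    exact (hψ.tendsto 0).comp this

theorem coulombConst_eq (hd : 1 ≤ d) :
    coulombConst d = slope ((d : ℝ) - 2) * d *
      (Real.pi ^ ((d : ℝ) / 2) / Real.Gamma ((d : ℝ) / 2 + 1)) := by
  have hd0 : (0 : ℝ) < d := by exact_mod_cast hd
  have hG : 0 < Real.Gamma ((d : ℝ) / 2) := Real.Gamma_pos_of_pos (by positivity)
  rw [Real.Gamma_add_one (by positivity)]
  unfold coulombConst slope
  by_cases h : d = 2
  · subst h
    norm_num [Real.Gamma_one]
  · have h' : (d : ℝ) - 2 ≠ 0 := by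
      rw [sub_ne_zero]; exact_mod_cast h
    rw [if_neg h, if_neg h']
    field_simp

/-- `-Δ K_{d-2} = c_d δ_0`. -/
theorem integral_coulomb_mul_laplacian (hd : 1 ≤ d) {s : ℝ} (hs : s + 2 = d)
    {ψ : 𝔼 → ℝ} (hψ : ContDiff ℝ 2 ψ) (hψc : HasCompactSupport ψ) :
    ∫ x : 𝔼, regKernel s 0 x * Laplacian.laplacian ψ x = -coulombConst d * ψ 0 := by
  obtain ⟨h1, h2, h3⟩ := one_div_succ_sq_facts
  have l1 := tendsto_integral_regKernel_mul hd (s := s) (by linarith)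
    (contDiff_laplacian (m := 0) hψ).continuous (hasCompactSupport_laplacian hψc) h1 h2 h3
  have l2 := tendsto_integral_laplacian_regKernel_mul_critical hd hs hψ.continuous hψc
  have e : (d : ℝ) - 2 = s := by linarith
  have e2 : -(slope s * d) * ((Real.pi ^ ((d : ℝ) / 2) / Real.Gamma ((d : ℝ) / 2 + 1)) * ψ 0) =
      -coulombConst d * ψ 0 := by rw [coulombConst_eq hd, e]; ring
  rw [e2] at l2
  refine tendsto_nhds_unique l1 (l2.congr fun k => ?_)
  exact (integral_mul_laplacian (contDiff_regKernel s (h1 k)) hψ hψc).symm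

/-! ### Recursion and sign of the constants, and the iterated fundamental solution. -/

theorem iterCoulombConst_one (d : ℕ) : iterCoulombConst d 1 = 1 := by
  have h : intDoubleFactorial ((d : ℤ) - 4) ≠ 0 := by
    unfold intDoubleFactorial; exact_mod_cast (Nat.doubleFactorial_pos _).ne'
  have e : (d : ℤ) - 2 * ((1 : ℕ) : ℤ) - 2 = d - 4 := by push_cast; ring
  have e2 : intDoubleFactorial (2 * ((1 : ℕ) : ℤ) - 2) = 1 := by simp [intDoubleFactorial]
  rw [iterCoulombConst, e, e2]
  field_simp
  simp

/-- The convention `z!! = 1` for `z ≤ 0` matches `slope 0 = 1` and `slope (-1) = 1`, so the usual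
recursion extends down to `z = -1`. This is where the range `s > -2` meets the double factorials. -/
theorem intDoubleFactorial_eq_slope_mul {z : ℤ} (hz : -2 < z) :
    intDoubleFactorial z = slope z * intDoubleFactorial (z - 2) := by
  unfold intDoubleFactorial slope
  obtain rfl | rfl | rfl | hz2 : z = -1 ∨ z = 0 ∨ z = 1 ∨ 2 ≤ z := by omega
  · have h : (-1 - 2 : ℤ).toNat = 0 := rfl
    have h' : (-1 : ℤ).toNat = 0 := rfl
    rw [h, h']
    norm_num
  · have h : (0 - 2 : ℤ).toNat = 0 := rfl
    rw [h]
    norm_num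
  · have h : (1 - 2 : ℤ).toNat = 0 := rfl
    rw [h]
    norm_num
  · obtain ⟨m, rfl⟩ : ∃ m : ℕ, z = m + 2 := ⟨(z - 2).toNat, by omega⟩
    have h1 : ((m : ℤ) + 2).toNat = m + 2 := by omega
    have h2 : ((m : ℤ) + 2 - 2).toNat = m := by omega
    have h3 : (((m : ℤ) + 2 : ℤ) : ℝ) ≠ 0 := by push_cast; positivity
    rw [h1, h2, if_neg h3, Nat.doubleFactorial_add_two, abs_of_pos (by push_cast; positivity)]
    push_cast; ring

/-- The factor is `-γ_s (d - s - 2)` at `s = d - 2 (n + 1)`, that is, the one produced by a single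
application of `Δ` to `K_s`. -/
theorem iterCoulombConst_succ {d n : ℕ} (hn : 1 ≤ n) (hs : (-2 : ℝ) < d - 2 * (n + 1 : ℕ)) :
    iterCoulombConst d (n + 1) =
      -(slope (d - 2 * (n + 1 : ℕ)) * (2 * n)) * iterCoulombConst d n := by
  have hz : (-2 : ℤ) < d - 2 * (n + 1 : ℕ) := by exact_mod_cast hs
  have h1 := intDoubleFactorial_eq_slope_mul hz
  have h2 := intDoubleFactorial_eq_slope_mul (z := 2 * (n : ℤ)) (by omega)
  have h3 : slope ((2 * (n : ℤ) : ℤ) : ℝ) = 2 * n := by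
    have : (0 : ℝ) < n := by exact_mod_cast hn
    unfold slope
    push_cast
    rw [if_neg (by positivity), abs_of_pos (by positivity)]
  rw [h3] at h2
  have h4 : intDoubleFactorial ((d : ℤ) - 2 * (n + 1 : ℕ) - 2) ≠ 0 := by
    unfold intDoubleFactorial; exact_mod_cast (Nat.doubleFactorial_pos _).ne'
  have h5 : slope (((d : ℤ) - 2 * (n + 1 : ℕ) : ℤ) : ℝ) = slope (d - 2 * (n + 1 : ℕ)) := by
    congr 1; push_cast; ring
  have h6 : (d : ℤ) - 2 * n - 2 = d - 2 * (n + 1 : ℕ) := by push_cast; ring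
  have h7 : 2 * ((n + 1 : ℕ) : ℤ) - 2 = 2 * n := by push_cast; ring
  have h8 := slope_pos (d - 2 * (n + 1 : ℕ))
  obtain ⟨m, rfl⟩ : ∃ m, n = m + 1 := ⟨n - 1, by omega⟩
  rw [h5] at h1
  unfold iterCoulombConst
  rw [h6, h7, h2, h1]
  simp only [Nat.add_sub_cancel]
  field_simp
  ring

theorem sign_iterCoulombConst (d : ℕ) {n : ℕ} :
    0 < (-1) ^ (n - 1) * iterCoulombConst d n := by
  have h : ∀ z : ℤ, 0 < intDoubleFactorial z := fun z => by
    unfold intDoubleFactorial; exact_mod_cast Nat.doubleFactorial_pos _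
  have h1 := h ((d : ℤ) - 4)
  have h2 := h (2 * (n : ℤ) - 2)
  have h3 := h ((d : ℤ) - 2 * (n : ℤ) - 2)
  have e : ((-1 : ℝ) ^ (n - 1)) * (-1) ^ (n - 1) = 1 := by
    rw [← mul_pow]; simp
  unfold iterCoulombConst
  rw [← mul_div_assoc, ← mul_assoc, e, one_mul]
  positivity

/-- `-Δ^n K_{d-2n} = c_d C_{d,n} δ_0`, tested at the origin. -/
theorem integral_regKernel_mul_iterLaplacian_zero {n : ℕ} (hn : 1 ≤ n) (hd : 1 ≤ d) {s : ℝ}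
    (hsd : s = (d : ℝ) - 2 * (n : ℕ)) (hs : -2 < s)
    {ψ : 𝔼 → ℝ} (hψ : ContDiff ℝ (⊤ : ℕ∞) ψ) (hψc : HasCompactSupport ψ) :
    ∫ x : 𝔼, regKernel s 0 x * iterLaplacian n ψ x =
      -(coulombConst d * iterCoulombConst d n) * ψ 0 := by
  induction n, hn using Nat.le_induction generalizing s with
  | base =>
    rw [iterCoulombConst_one, mul_one]
    exact integral_coulomb_mul_laplacian hd (by rw [hsd]; push_cast; ring)
      (contDiff_infty.1 hψ 2) hψc
  | succ n hn ih =>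
    have hn0 : (0 : ℝ) < n := by exact_mod_cast hn
    have hsd2 : s + 2 = (d : ℝ) - 2 * (n : ℕ) := by rw [hsd]; push_cast; ring
    -- One Laplacian is moved onto `K_s`, raising the exponent to `s + 2 = d - 2n`; the induction
    -- hypothesis handles the remaining `n`.
    rw [iterLaplacian_succ', integral_regKernel_zero_mul_laplacian hd hs (by linarith)
      (contDiff_infty.1 (contDiff_top_iterLaplacian n hψ) 2)
      (hasCompactSupport_iterLaplacian n hψc), ih hsd2 (by linarith),
      iterCoulombConst_succ hn (by rw [← hsd]; exact hs), ← hsd]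
    have : (d : ℝ) - s - 2 = 2 * n := by linarith
    rw [this]
    ring

/-- `-Δ^n K_{d-2n}(· - y) = c_d C_{d,n} δ_y`. -/
theorem integral_regKernel_sub_mul_iterLaplacian {n : ℕ} (hn : 1 ≤ n) (hd : 1 ≤ d) {s : ℝ}
    (hsd : s = (d : ℝ) - 2 * (n : ℕ)) (hs : -2 < s)
    {ψ : 𝔼 → ℝ} (hψ : ContDiff ℝ (⊤ : ℕ∞) ψ) (hψc : HasCompactSupport ψ) (y : 𝔼) :
    ∫ x : 𝔼, regKernel s 0 (x - y) * iterLaplacian n ψ x =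
      -(coulombConst d * iterCoulombConst d n) * ψ y := by
  have h := integral_regKernel_mul_iterLaplacian_zero hn hd hsd hs
    (ψ := fun x => ψ (x + y)) (hψ.comp (contDiff_id.add contDiff_const))
    (hψc.comp_homeomorph (Homeomorph.addRight y))
  rw [iterLaplacian_comp_add_right, zero_add] at h
  rw [← h, ← integral_add_right_eq_self _ y]
  simp

end RieszKernel

/-! ### Minimizers of a quadratic energy with nonnegative kernel. -/

section Minimizer

open scoped ENNReal

variable {α : Type*} [MeasurableSpace α] {κ : α × α → ℝ≥0∞} {μ : Measure α}

/-- Subtracting `e` and dividing by `t` leaves `2 (e - p) ≤ t (e - 2p + q)`. If `p < e`, the choice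
`t = (e - p) / D` keeps `t < 1` and bounds the right side by `e - p`, a contradiction. -/
theorem le_of_forall_quadratic_le {e p q : ℝ}
    (h : ∀ t : ℝ, 0 < t → t < 1 → e ≤ (1 - t) ^ 2 * e + 2 * (t * (1 - t)) * p + t ^ 2 * q) :
    e ≤ p := by
  by_contra! hlt
  set D := |e - 2 * p + q| + (e - p) + 1 with hD
  have hD0 : 0 < D := by positivity [sub_pos.mpr hlt]
  have ht0 : 0 < (e - p) / D := div_pos (sub_pos.mpr hlt) hD0
  have ht1 : (e - p) / D < 1 := by
    rw [div_lt_one hD0]; linarith [abs_nonneg (e - 2 * p + q)]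
  have h1 := h _ ht0 ht1
  set t := (e - p) / D
  have h2 : t * D = e - p := div_mul_cancel₀ _ hD0.ne'
  have h3 : t * (2 * (e - p)) ≤ t * (t * (e - 2 * p + q)) := by nlinarith
  have h4 := le_of_mul_le_mul_left h3 ht0
  have h5 : t * (e - 2 * p + q) ≤ t * D :=
    mul_le_mul_of_nonneg_left (by linarith [le_abs_self (e - 2 * p + q)]) ht0.le
  linarith

theorem lintegral_prod_add_smul (hκ : Measurable κ) (hsymm : ∀ x y, κ (x, y) = κ (y, x))
    {ν : Measure α} [IsFiniteMeasure μ] [IsFiniteMeasure ν] (a b : NNReal) :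
    ∫⁻ p, κ p ∂((a • μ + b • ν).prod (a • μ + b • ν)) =
      a ^ 2 * ∫⁻ p, κ p ∂(μ.prod μ) + 2 * (b * a) * (∫⁻ x, ∫⁻ y, κ (x, y) ∂μ ∂ν) +
        b ^ 2 * ∫⁻ p, κ p ∂(ν.prod ν) := by
  have hm : ∀ (ρ : Measure α) [SFinite ρ], Measurable fun x => ∫⁻ y, κ (x, y) ∂ρ :=
    fun ρ _ => hκ.lintegral_prod_right'
  have hswap : ∫⁻ x, ∫⁻ y, κ (x, y) ∂ν ∂μ = ∫⁻ x, ∫⁻ y, κ (x, y) ∂μ ∂ν := by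
    rw [lintegral_lintegral_swap (f := fun x y => κ (x, y)) hκ.aemeasurable]
    simp only [hsymm]
  rw [lintegral_prod _ hκ.aemeasurable, lintegral_prod _ hκ.aemeasurable,
    lintegral_prod _ hκ.aemeasurable]
  simp only [lintegral_add_measure, lintegral_smul_measure, ENNReal.smul_def, smul_eq_mul]
  rw [lintegral_add_left ((hm μ).const_mul _), lintegral_add_left ((hm μ).const_mul _),
    lintegral_const_mul _ (hm μ), lintegral_const_mul _ (hm μ), lintegral_const_mul _ (hm ν),
    lintegral_const_mul _ (hm ν), hswap]
  ring

/-- First order optimality condition for the minimizers of a quadratic energy. -/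
theorem energy_le_lintegral_potential (hκ : Measurable κ) (hsymm : ∀ x y, κ (x, y) = κ (y, x))
    [IsProbabilityMeasure μ] (hfin : ∫⁻ p, κ p ∂(μ.prod μ) ≠ ∞)
    (hmin : ∀ ν : Measure α, IsProbabilityMeasure ν →
      ∫⁻ p, κ p ∂(μ.prod μ) ≤ ∫⁻ p, κ p ∂(ν.prod ν))
    {ν : Measure α} [IsProbabilityMeasure ν] (hν : ∫⁻ p, κ p ∂(ν.prod ν) ≠ ∞) :
    ∫⁻ p, κ p ∂(μ.prod μ) ≤ ∫⁻ x, ∫⁻ y, κ (x, y) ∂μ ∂ν := by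
  by_cases hp : ∫⁻ x, ∫⁻ y, κ (x, y) ∂μ ∂ν = ∞
  · rw [hp]; exact le_top
  rw [← ENNReal.toReal_le_toReal hfin hp]
  refine le_of_forall_quadratic_le (q := (∫⁻ p, κ p ∂(ν.prod ν)).toReal) fun t ht0 ht1 => ?_
  let a : NNReal := ⟨1 - t, by linarith⟩
  let b : NNReal := ⟨t, ht0.le⟩
  have ha : (a : ℝ) = 1 - t := rfl
  have hb : (b : ℝ) = t := rfl
  have hab : a + b = 1 := by ext; rw [NNReal.coe_add, ha, hb, NNReal.coe_one]; ring
  have hprob : IsProbabilityMeasure (a • μ + b • ν) := ⟨by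
    simp only [Measure.add_apply, Measure.smul_apply, measure_univ, ENNReal.smul_def,
      smul_eq_mul, mul_one]
    exact_mod_cast hab⟩
  have h := hmin _ hprob
  rw [lintegral_prod_add_smul hκ hsymm] at h
  have hA : (a : ℝ≥0∞) ^ 2 * ∫⁻ p, κ p ∂(μ.prod μ) ≠ ∞ :=
    ENNReal.mul_ne_top (by simp) hfin
  have hB : 2 * ((b : ℝ≥0∞) * a) * (∫⁻ x, ∫⁻ y, κ (x, y) ∂μ ∂ν) ≠ ∞ :=
    ENNReal.mul_ne_top (by finiteness) hp
  have hC : (b : ℝ≥0∞) ^ 2 * ∫⁻ p, κ p ∂(ν.prod ν) ≠ ∞ :=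
    ENNReal.mul_ne_top (by simp) hν
  have h2 := ENNReal.toReal_mono (ENNReal.add_ne_top.mpr ⟨ENNReal.add_ne_top.mpr ⟨hA, hB⟩, hC⟩) h
  rw [ENNReal.toReal_add (ENNReal.add_ne_top.mpr ⟨hA, hB⟩) hC, ENNReal.toReal_add hA hB] at h2
  simp only [ENNReal.toReal_mul, ENNReal.toReal_pow, ENNReal.coe_toReal, ENNReal.toReal_ofNat,
    ha, hb] at h2
  exact h2

/-- A set of positive measure and finite self-energy is not contained in `{P < E}`. -/
theorem measure_eq_zero_of_potential_lt (hκ : Measurable κ)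
    (hsymm : ∀ x y, κ (x, y) = κ (y, x))
    [IsProbabilityMeasure μ] (hfin : ∫⁻ p, κ p ∂(μ.prod μ) ≠ ∞)
    (hmin : ∀ ν : Measure α, IsProbabilityMeasure ν →
      ∫⁻ p, κ p ∂(μ.prod μ) ≤ ∫⁻ p, κ p ∂(ν.prod ν))
    {m : Measure α} {A : Set α} (hA : MeasurableSet A) (hmA : m A ≠ ∞)
    (hen : ∫⁻ x in A, ∫⁻ y in A, κ (x, y) ∂m ∂m ≠ ∞)
    (hlt : ∀ x ∈ A, ∫⁻ y, κ (x, y) ∂μ < ∫⁻ p, κ p ∂(μ.prod μ)) : m A = 0 := by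
  by_contra h0
  have hfinA : IsFiniteMeasure (m.restrict A) := ⟨by simpa using hmA.lt_top⟩
  -- The competitor is `m` conditioned on `A`: integrating `P < E` against it contradicts the first
  -- order condition. The measure `m` is left free because both `μ` and Lebesgue measure are used
  -- later.
  set ν : Measure α := (m A)⁻¹ • m.restrict A with hν
  have hνp : IsProbabilityMeasure ν := ⟨by
    simp [hν, ENNReal.inv_mul_cancel h0 hmA]⟩
  have hinv : (m A)⁻¹ ≠ ∞ := ENNReal.inv_ne_top.mpr h0
  have hP : Measurable fun x => ∫⁻ y, κ (x, y) ∂μ := hκ.lintegral_prod_right'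
  have hνfin : ∫⁻ p, κ p ∂(ν.prod ν) ≠ ∞ := by
    rw [lintegral_prod _ hκ.aemeasurable]
    simp only [hν, lintegral_smul_measure, smul_eq_mul]
    rw [lintegral_const_mul _ hκ.lintegral_prod_right']
    exact ENNReal.mul_ne_top hinv (ENNReal.mul_ne_top hinv hen)
  have h1 := energy_le_lintegral_potential hκ hsymm hfin hmin hνfin
  rw [hν, lintegral_smul_measure, smul_eq_mul] at h1
  have h2 : ∫⁻ x in A, ∫⁻ y, κ (x, y) ∂μ ∂m < ∫⁻ x in A, ∫⁻ p, κ p ∂(μ.prod μ) ∂m := by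
    refine setLIntegral_strict_mono hA h0 measurable_const ?_ (ae_of_all _ hlt)
    refine ne_top_of_le_ne_top (ENNReal.mul_ne_top hfin hmA) ?_
    rw [← setLIntegral_const]
    exact setLIntegral_mono measurable_const fun x hx => (hlt x hx).le
  rw [setLIntegral_const] at h2
  have h3 : (m A)⁻¹ * ∫⁻ x in A, ∫⁻ y, κ (x, y) ∂μ ∂m <
      (m A)⁻¹ * ((∫⁻ p, κ p ∂(μ.prod μ)) * m A) :=
    ENNReal.mul_lt_mul_right (ENNReal.inv_ne_zero.mpr hmA) hinv h2
  rw [mul_left_comm, ENNReal.inv_mul_cancel h0 hmA, mul_one] at h3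
  exact absurd h1 (not_le.mpr h3)

/-- The set `{P < E}` has finite `μ`-self-energy, so it is `μ`-null; then `P ≥ E` almost everywhere
while `∫ P dμ = E`, which forces equality. -/
theorem potential_ae_eq_energy (hκ : Measurable κ)
    (hsymm : ∀ x y, κ (x, y) = κ (y, x))
    [IsProbabilityMeasure μ] (hfin : ∫⁻ p, κ p ∂(μ.prod μ) ≠ ∞)
    (hmin : ∀ ν : Measure α, IsProbabilityMeasure ν →
      ∫⁻ p, κ p ∂(μ.prod μ) ≤ ∫⁻ p, κ p ∂(ν.prod ν)) :
    ∀ᵐ x ∂μ, ∫⁻ y, κ (x, y) ∂μ = ∫⁻ p, κ p ∂(μ.prod μ) := by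
  have hP : Measurable fun x => ∫⁻ y, κ (x, y) ∂μ := hκ.lintegral_prod_right'
  have hint : ∫⁻ x, ∫⁻ y, κ (x, y) ∂μ ∂μ = ∫⁻ p, κ p ∂(μ.prod μ) :=
    (lintegral_prod _ hκ.aemeasurable).symm
  have hge : ∀ᵐ x ∂μ, ∫⁻ p, κ p ∂(μ.prod μ) ≤ ∫⁻ y, κ (x, y) ∂μ := by
    rw [ae_iff]
    simp only [not_le]
    refine measure_eq_zero_of_potential_lt hκ hsymm hfin hmin
      (measurableSet_lt hP measurable_const) (measure_ne_top _ _) ?_ (fun x hx => hx)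
    refine ne_top_of_le_ne_top hfin ?_
    rw [← hint]
    exact (setLIntegral_le_lintegral _ _).trans
      (lintegral_mono fun x => setLIntegral_le_lintegral _ _)
  have := ae_eq_of_ae_le_of_lintegral_le (f := fun _ => ∫⁻ p, κ p ∂(μ.prod μ))
    (g := fun x => ∫⁻ y, κ (x, y) ∂μ) (μ := μ) hge (by simpa using hfin) hP.aemeasurable
    (by rw [hint]; simp)
  filter_upwards [this] with x hx using hx.symm

/-- Neighborhoods of a support point have positive mass, so the point is a limit of points where `P
≤ E`. By Fatou, `P` inherits lower semicontinuity from `κ`, and the bound passes to the limit. -/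
theorem potential_le_of_mem_support [TopologicalSpace α] [FirstCountableTopology α]
    (hκ : Measurable κ) (hlsc : ∀ y, LowerSemicontinuous fun x => κ (x, y)) {E : ℝ≥0∞}
    (hae : ∀ᵐ x ∂μ, ∫⁻ y, κ (x, y) ∂μ ≤ E) {x : α} (hx : x ∈ μ.support) :
    ∫⁻ y, κ (x, y) ∂μ ≤ E := by
  have hcl : x ∈ closure {x | ∫⁻ y, κ (x, y) ∂μ ≤ E} := by
    rw [mem_closure_iff_nhds]
    intro U hU
    have hpos := (Measure.mem_support_iff_forall x).mp hx U hU
    by_contra hne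
    rw [Set.not_nonempty_iff_eq_empty] at hne
    have hsub : U ⊆ {x | ¬ ∫⁻ y, κ (x, y) ∂μ ≤ E} := fun z hz hz2 =>
      Set.eq_empty_iff_forall_notMem.mp hne z ⟨hz, hz2⟩
    exact hpos.ne' (measure_mono_null hsub (ae_iff.mp hae))
  obtain ⟨u, hu, hlim⟩ := mem_closure_iff_seq_limit.mp hcl
  calc ∫⁻ y, κ (x, y) ∂μ ≤ ∫⁻ y, Filter.liminf (fun n => κ (u n, y)) Filter.atTop ∂μ := by
        refine lintegral_mono fun y => ?_
        have h1 := lowerSemicontinuousAt_iff_le_liminf.mp ((hlsc y).lowerSemicontinuousAt x)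
        exact h1.trans (Filter.liminf_le_liminf_of_le hlim)
    _ ≤ Filter.liminf (fun n => ∫⁻ y, κ (u n, y) ∂μ) Filter.atTop :=
        lintegral_liminf_le fun n => hκ.comp measurable_prodMk_left
    _ ≤ E := by
        refine Filter.liminf_le_of_frequently_le' (Filter.Frequently.of_forall hu)

end Minimizer

/-! ### Comparison and semicontinuity estimates for the kernel. -/

section KernelEstimates

variable {d : ℕ}

local notation "𝔼" => EuclideanSpace ℝ (Fin d)

/-- The radial derivative has size `slope s · |r| (r² + 1)^(-(s+2)/2)`. Since `|r| ≤ (r² +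
1)^(1/2)`, it is bounded by `slope s` precisely because `s ≥ -1`. -/
theorem abs_regKernel_one_sub_le {s : ℝ} (hs : -1 ≤ s) (x y : 𝔼) :
    |regKernel s 1 x - regKernel s 1 y| ≤ slope s * ‖x - y‖ := by
  have hsl := slope_pos s
  have key : ∀ a b : ℝ, |profile s (b ^ 2 + 1) - profile s (a ^ 2 + 1)| ≤ slope s * |b - a| := by
    intro a b
    refine Convex.norm_image_sub_le_of_norm_hasDerivWithin_le (s := Set.univ)
      (f := fun r : ℝ => profile s (r ^ 2 + 1))
      (f' := fun r => -(slope s / 2) * (r ^ 2 + 1) ^ (-(s + 2) / 2) * (2 * r))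
      (fun r _ => ?_) (fun r _ => ?_) convex_univ (Set.mem_univ _) (Set.mem_univ _)
    · have h1 : HasDerivAt (fun r : ℝ => r ^ 2 + 1) (2 * r) r := by
        simpa using (hasDerivAt_pow 2 r).add_const 1
      exact ((hasDerivAt_profile s (by positivity)).comp r h1).hasDerivWithinAt
    · have hρ : 0 < r ^ 2 + 1 := by positivity
      have h1 : |r| ≤ (r ^ 2 + 1) ^ ((1 : ℝ) / 2) := by
        rw [← Real.sqrt_eq_rpow]
        exact Real.abs_le_sqrt (by linarith)
      have h2 : (r ^ 2 + 1) ^ (-(s + 2) / 2) * (r ^ 2 + 1) ^ ((1 : ℝ) / 2) ≤ 1 := by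
        rw [← Real.rpow_add hρ]
        exact Real.rpow_le_one_of_one_le_of_nonpos (by nlinarith [sq_nonneg r]) (by linarith)
      have h3 : 0 < (r ^ 2 + 1) ^ (-(s + 2) / 2) := Real.rpow_pos_of_pos hρ _
      rw [norm_mul, norm_mul, Real.norm_eq_abs, Real.norm_eq_abs, Real.norm_eq_abs, abs_neg,
        abs_of_pos (by positivity : 0 < slope s / 2), abs_of_pos h3, abs_mul,
        abs_of_pos (two_pos : (0 : ℝ) < 2)]
      have h4 : (r ^ 2 + 1) ^ (-(s + 2) / 2) * |r| ≤ 1 :=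
        (mul_le_mul_of_nonneg_left h1 h3.le).trans h2
      nlinarith
  exact (key ‖y‖ ‖x‖).trans (mul_le_mul_of_nonneg_left (abs_norm_sub_norm_le x y) hsl.le)

/-- On `t ≥ 1` the profile has derivative at most `slope s / 2` in absolute value, and the two
arguments differ by `1`. -/
theorem regKernel_zero_le_of_one_le_norm {s : ℝ} (hs : -2 < s) {z : 𝔼} (hz : 1 ≤ ‖z‖) :
    regKernel s 0 z ≤ regKernel s 1 z + slope s / 2 := by
  have hsl := slope_pos s
  have h1 : (1 : ℝ) ≤ ‖z‖ ^ 2 := one_le_pow₀ hz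
  have := Convex.norm_image_sub_le_of_norm_hasDerivWithin_le (s := Set.Ici (1 : ℝ))
    (f := profile s) (f' := fun t => -(slope s / 2) * t ^ (-(s + 2) / 2)) (C := slope s / 2)
    (x := ‖z‖ ^ 2 + 1) (y := ‖z‖ ^ 2 + 0)
    (fun t ht => (hasDerivAt_profile s (zero_lt_one.trans_le ht)).hasDerivWithinAt)
    (fun t ht => ?_) (convex_Ici 1) (by simp) (by simpa using h1)
  · have h2 := (le_abs_self _).trans this
    have h3 : ‖(‖z‖ ^ 2 + 0) - (‖z‖ ^ 2 + 1)‖ = 1 := by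
      rw [add_sub_add_left_eq_sub]; norm_num
    rw [h3, mul_one] at h2
    unfold regKernel
    linarith
  · have ht1 : (1 : ℝ) ≤ t := ht
    have h4 : t ^ (-(s + 2) / 2) ≤ 1 :=
      Real.rpow_le_one_of_one_le_of_nonpos ht1 (by linarith)
    have h5 : 0 ≤ t ^ (-(s + 2) / 2) := by positivity
    rw [norm_mul, Real.norm_eq_abs, abs_neg, abs_of_pos (by positivity), Real.norm_of_nonneg h5]
    exact mul_le_of_le_one_right (by positivity) h4

theorem regKernel_one_le_zero {s : ℝ} {z : 𝔼} (hz : z ≠ 0 ∨ s < 0) :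
    regKernel s 1 z ≤ regKernel s 0 z := by
  by_cases h : z = 0
  · have hs : s < 0 := hz.resolve_left (not_not.mpr h)
    have h2 : -s / 2 ≠ 0 := by linarith
    simp [regKernel, profile, h, hs.ne, Real.sign_of_neg hs, Real.zero_rpow h2]
  · exact regKernel_anti s zero_le_one z (by positivity)

theorem rieszKernel_of_neg {s : ℝ} (hs : s < 0) (x : 𝔼) :
    rieszKernel s x = (regKernel s 0 x : ℝ) := by
  rw [← toReal_rieszKernel]
  unfold rieszKernel
  rw [if_neg (by simp [hs]), if_neg hs.ne, EReal.toReal_coe]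

theorem rieszKernel_zero_eq_top {s : ℝ} (hs : 0 ≤ s) : rieszKernel s (0 : 𝔼) = ⊤ := by
  simp [rieszKernel, hs]

theorem rieszKernel_ne_bot (s : ℝ) (x : 𝔼) : rieszKernel s x ≠ ⊥ := by
  unfold rieszKernel
  split_ifs
  · simp
  · exact EReal.coe_ne_bot _
  · exact EReal.coe_ne_bot _

theorem rieszKernel_neg_arg (s : ℝ) (x : 𝔼) : rieszKernel s (-x) = rieszKernel s x := by
  simp [rieszKernel]

theorem tendsto_profile_atTop {s : ℝ} (hs : 0 ≤ s) :
    Filter.Tendsto (profile s) (nhdsWithin 0 (Set.Ioi 0)) Filter.atTop := by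
  rcases hs.eq_or_lt with h | h
  · have e : profile s = fun t => -(Real.log t) / 2 := by
      funext t; simp [profile, ← h]
    rw [e]
    exact (Filter.tendsto_neg_atBot_atTop.comp Real.tendsto_log_nhdsGT_zero).atTop_div_const
      two_pos
  · have e : profile s = fun t => t ^ (-s / 2) := by funext t; exact profile_of_pos h t
    rw [e]
    exact tendsto_rpow_neg_nhdsGT_zero (by linarith)

theorem continuousAt_regKernel_zero (s : ℝ) {x : 𝔼} (hx : x ≠ 0) :
    ContinuousAt (regKernel s 0 : 𝔼 → ℝ) x := by
  have hx2 : 0 < ‖x‖ ^ 2 + 0 := by positivity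
  exact (hasDerivAt_profile s hx2).continuousAt.comp (f := fun x : 𝔼 => ‖x‖ ^ 2 + 0)
    (by fun_prop)

theorem lowerSemicontinuous_rieszKernel (s : ℝ) :
    LowerSemicontinuous (rieszKernel s : 𝔼 → EReal) := by
  intro x
  by_cases hx : x = 0
  · rcases lt_or_ge s 0 with hs | hs
    · have e : (rieszKernel s : 𝔼 → EReal) = fun x => ((regKernel s 0 x : ℝ) : EReal) := by
        funext x; exact rieszKernel_of_neg hs x
      rw [e]
      refine Continuous.lowerSemicontinuous (continuous_coe_real_ereal.comp ?_) x
      have e2 : (regKernel s 0 : 𝔼 → ℝ) = fun x => Real.sign s * (‖x‖ ^ 2) ^ (-s / 2) := by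
        funext x; simp [regKernel, profile, hs.ne]
      rw [e2]
      exact continuous_const.mul ((by fun_prop : Continuous fun x : 𝔼 => ‖x‖ ^ 2).rpow_const
        fun _ => Or.inr (by linarith))
    · intro a ha
      rw [hx, rieszKernel_zero_eq_top hs] at ha
      obtain ⟨r, hr, -⟩ := EReal.lt_iff_exists_real_btwn.mp ha
      have h1 : Filter.Tendsto (fun x : 𝔼 => ‖x‖ ^ 2 + 0) (nhdsWithin 0 {0}ᶜ)
          (nhdsWithin 0 (Set.Ioi 0)) := by
        refine tendsto_nhdsWithin_iff.mpr ⟨?_, ?_⟩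
        · have : Continuous fun x : 𝔼 => ‖x‖ ^ 2 + 0 := by fun_prop
          simpa using (this.tendsto 0).mono_left nhdsWithin_le_nhds
        · filter_upwards [self_mem_nhdsWithin] with z hz
          have hz' : z ≠ 0 := hz
          exact Set.mem_Ioi.mpr (by positivity)
      have h2 := (tendsto_profile_atTop hs).comp h1
      have h3 := h2.eventually_gt_atTop r
      rw [eventually_nhdsWithin_iff] at h3
      rw [hx]
      filter_upwards [h3] with z hz
      by_cases hz0 : z = 0
      · rw [hz0, rieszKernel_zero_eq_top hs]; exact ha
      · rw [rieszKernel_of_ne_zero s hz0]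
        exact hr.trans (EReal.coe_lt_coe_iff.mpr (hz hz0))
  · have h1 : ContinuousAt (fun x => ((regKernel s 0 x : ℝ) : EReal)) x :=
      continuous_coe_real_ereal.continuousAt.comp (continuousAt_regKernel_zero s hx)
    have h2 : rieszKernel s =ᶠ[nhds x] fun x => ((regKernel s 0 x : ℝ) : EReal) := by
      filter_upwards [isOpen_ne.mem_nhds hx] with z hz using rieszKernel_of_ne_zero s hz
    exact (h1.congr h2.symm).lowerSemicontinuousAt

end KernelEstimates

/-! ### Lower bounds for the interaction and reduction to a nonnegative kernel. -/

section Energy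

variable {d : ℕ} {s : ℝ} {V : EuclideanSpace ℝ (Fin d) → EReal}

local notation "𝔼" => EuclideanSpace ℝ (Fin d)

theorem IsExternalField.exists_le_add_regKernel (hV : IsExternalField s V) (hs : -1 ≤ s)
    {y₀ : 𝔼} (hy₀ : V y₀ ≠ ⊤) :
    ∃ M : ℝ, ∀ y, V y ≠ ⊤ → M ≤ (V y).toReal + regKernel s 1 y := by
  obtain ⟨C, hC⟩ := hV.bounded_below
  obtain ⟨y₁, hy₁, hmin⟩ := (hV.lowerSemicontinuous.lowerSemicontinuousOn
    (Metric.closedBall y₀ 1)).exists_isMinOn ⟨y₀, by simp⟩ (isCompact_closedBall y₀ 1)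
  obtain ⟨y₂, hy₂, hmin₂⟩ := (isCompact_closedBall y₀ 1).exists_isMinOn ⟨y₀, by simp⟩
    (contDiff_regKernel s one_pos (m := 0)).continuous.continuousOn
  have hV1 : V y₁ ≠ ⊤ := ne_top_of_le_ne_top hy₀ (hmin (by simp))
  -- Within distance `1` of `y₀`, lower semicontinuity of `V` and compactness give the first bound.
  -- Farther away, the interaction with `y₀` bounds `V y` below by `C - V y₀ - K_s(y - y₀)`, and
  -- `K_s(y - y₀)` is compared with `regKernel s 1 y`.
  refine ⟨min ((V y₁).toReal + regKernel s 1 y₂)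
    (C - (V y₀).toReal - slope s / 2 - slope s * ‖y₀‖), fun y hy => ?_⟩
  by_cases hyb : y ∈ Metric.closedBall y₀ 1
  · refine (min_le_left _ _).trans (add_le_add ?_ (hmin₂ hyb))
    exact EReal.toReal_le_toReal (hmin hyb) (hV.ne_bot _) hy
  · refine (min_le_right _ _).trans ?_
    rw [Metric.mem_closedBall, not_le, dist_eq_norm] at hyb
    have hne : y - y₀ ≠ 0 := fun h => by rw [h, norm_zero] at hyb; linarith
    have h1 := hC y y₀ (sub_ne_zero.mp hne)
    rw [rieszKernel_of_ne_zero s hne, ← EReal.coe_toReal hy (hV.ne_bot y),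
      ← EReal.coe_toReal hy₀ (hV.ne_bot y₀)] at h1
    norm_cast at h1
    have h2 := regKernel_zero_le_of_one_le_norm (by linarith : -2 < s) hyb.le
    have h3 := (abs_le.mp (abs_regKernel_one_sub_le hs (y - y₀) y)).2
    have h4 : ‖y - y₀ - y‖ = ‖y₀‖ := by rw [sub_sub_cancel_left, norm_neg]
    rw [h4] at h3
    linarith

/-- The given bound omits the diagonal. There the interaction is `+∞` if `s ≥ 0`; if `s < 0` it is
`2 V x`, which is bounded below because `regKernel s 1 ≤ 0`. -/
theorem IsExternalField.exists_neg_le (hV : IsExternalField s V) (hs : -1 ≤ s)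
    {y₀ : 𝔼} (hy₀ : V y₀ ≠ ⊤) :
    ∃ C : ℝ, 0 ≤ C ∧ ∀ x y, ((-C : ℝ) : EReal) ≤ rieszKernel s (x - y) + V x + V y := by
  obtain ⟨C, hC⟩ := hV.bounded_below
  obtain ⟨M, hM⟩ := hV.exists_le_add_regKernel hs hy₀
  refine ⟨|C| + 2 * |M|, by positivity, fun x y => ?_⟩
  have hle : ((-(|C| + 2 * |M|) : ℝ) : EReal) ≤ (C : EReal) :=
    EReal.coe_le_coe_iff.mpr (by linarith [neg_abs_le C, abs_nonneg M])
  by_cases hxy : x = y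
  · subst hxy
    by_cases hx : V x = ⊤
    · rw [hx, EReal.add_top_of_ne_bot]
      · exact le_top
      · rw [EReal.add_top_of_ne_bot (rieszKernel_ne_bot _ _)]; simp
    rcases lt_or_ge s 0 with hs0 | hs0
    · have h1 := hM x hx
      have h2 : regKernel s 1 x ≤ 0 := by
        have : (0 : ℝ) ≤ (‖x‖ ^ 2 + 1) ^ (-s / 2) := by positivity
        simpa [regKernel, profile, hs0.ne, Real.sign_of_neg hs0] using this
      have h3 : regKernel s 0 (0 : 𝔼) = 0 := by
        have : -s / 2 ≠ 0 := by linarith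
        simp [regKernel, profile, hs0.ne, Real.zero_rpow this]
      rw [sub_self, rieszKernel_of_neg hs0, ← EReal.coe_toReal hx (hV.ne_bot x), h3]
      norm_cast
      linarith [neg_abs_le M, abs_nonneg C]
    · rw [sub_self, rieszKernel_zero_eq_top hs0, EReal.top_add_of_ne_bot (hV.ne_bot x),
        EReal.top_add_of_ne_bot (hV.ne_bot x)]
      exact le_top
  · exact hle.trans (hC x y hxy)

theorem toENNReal_add_add_toENNReal_neg {C : ℝ} (hC : 0 ≤ C) {a : EReal}
    (ha : ((-C : ℝ) : EReal) ≤ a) :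
    (a + C).toENNReal + (-a).toENNReal = a.toENNReal + ENNReal.ofReal C := by
  induction a with
  | bot => simp at ha
  | top => simp
  | coe r =>
    have hr : -C ≤ r := EReal.coe_le_coe_iff.mp ha
    rw [← EReal.coe_add, ← EReal.coe_neg]
    simp only [EReal.toENNReal_of_ne_top (EReal.coe_ne_top _), EReal.toReal_coe]
    rcases le_total 0 r with h | h
    · rw [ENNReal.ofReal_of_nonpos (by linarith : -r ≤ 0), add_zero, ENNReal.ofReal_add h hC]
    · rw [ENNReal.ofReal_of_nonpos h, zero_add,
        ← ENNReal.ofReal_add (by linarith) (by linarith)]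
      congr 1; ring

/-- The pointwise identity `(f + C)⁺ + f⁻ = f⁺ + C` is integrated; since `f⁻ ≤ C` has finite
integral, it can be subtracted. -/
theorem extIntegral_add_coe {α : Type*} [MeasurableSpace α] (m : Measure α)
    [IsProbabilityMeasure m] {f : α → EReal} (hf : Measurable f) {C : ℝ} (hC : 0 ≤ C)
    (hfC : ∀ a, ((-C : ℝ) : EReal) ≤ f a) :
    extIntegral m f + C = ((∫⁻ a, (f a + C).toENNReal ∂m : ENNReal) : EReal) := by
  have h1 : ∫⁻ a, (f a + C).toENNReal ∂m + ∫⁻ a, (-f a).toENNReal ∂m =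
      ∫⁻ a, (f a).toENNReal ∂m + ENNReal.ofReal C := by
    rw [← lintegral_add_right _ (by fun_prop)]
    simp only [toENNReal_add_add_toENNReal_neg hC (hfC _)]
    rw [lintegral_add_right _ measurable_const]
    simp
  have h2 : ∫⁻ a, (-f a).toENNReal ∂m ≤ ENNReal.ofReal C := by
    calc _ ≤ ∫⁻ _, ENNReal.ofReal C ∂m := by
          refine lintegral_mono fun a => ?_
          have : -f a ≤ (C : EReal) := by
            rw [EReal.neg_le]; exact_mod_cast hfC a
          refine (EReal.toENNReal_le_toENNReal this).trans ?_
          simp [EReal.toENNReal_of_ne_top]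
      _ = _ := by simp
  have h3 : ∫⁻ a, (-f a).toENNReal ∂m ≠ ⊤ := ne_top_of_le_ne_top ENNReal.ofReal_ne_top h2
  unfold extIntegral
  generalize ∫⁻ a, (f a + C).toENNReal ∂m = A at *
  generalize ∫⁻ a, (-f a).toENNReal ∂m = N at *
  generalize ∫⁻ a, (f a).toENNReal ∂m = P at *
  have hA : A = P + ENNReal.ofReal C - N := ENNReal.eq_sub_of_add_eq h3 h1
  lift N to NNReal using h3
  by_cases hP : P = ⊤
  · rw [hA, hP]
    simp only [EReal.coe_ennreal_top, top_add]
    rw [ENNReal.top_sub_coe]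
    have : (((N : NNReal) : ENNReal) : EReal) = ((N : ℝ) : EReal) := rfl
    rw [this, EReal.top_sub_coe, EReal.top_add_coe, EReal.coe_ennreal_top]
  · have hA' : A ≠ ⊤ := by
      intro h; rw [h, top_add] at h1
      exact (ENNReal.add_ne_top.mpr ⟨hP, ENNReal.ofReal_ne_top⟩) h1.symm
    lift P to NNReal using hP
    lift A to NNReal using hA'
    have h4 := congrArg ENNReal.toReal h1
    rw [ENNReal.toReal_add (by simp) (by simp), ENNReal.toReal_add (by simp) (by simp),
      ENNReal.toReal_ofReal hC] at h4
    simp only [ENNReal.coe_toReal] at h4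
    have e : ∀ z : NNReal, (((z : NNReal) : ENNReal) : EReal) = ((z : ℝ) : EReal) := fun _ => rfl
    rw [e, e, e, ← EReal.coe_sub, ← EReal.coe_add]
    congr 1
    linarith

/-- The interaction `K_s(x-y) + V(x) + V(y)`, shifted by a constant to be nonnegative. -/
def shiftedKernel (s : ℝ) (V : 𝔼 → EReal) (C : ℝ) (p : 𝔼 × 𝔼) : ENNReal :=
  (rieszKernel s (p.1 - p.2) + V p.1 + V p.2 + C).toENNReal

theorem IsExternalField.measurable_interaction (hV : IsExternalField s V) :
    Measurable fun p : 𝔼 × 𝔼 => rieszKernel s (p.1 - p.2) + V p.1 + V p.2 := by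
  have h1 : Measurable V := hV.lowerSemicontinuous.measurable
  have h2 : Measurable (rieszKernel s : 𝔼 → EReal) :=
    (lowerSemicontinuous_rieszKernel s).measurable
  fun_prop

theorem IsExternalField.measurable_shiftedKernel (hV : IsExternalField s V) (C : ℝ) :
    Measurable (shiftedKernel s V C) := by
  have := hV.measurable_interaction
  unfold shiftedKernel
  fun_prop

theorem shiftedKernel_symm (s : ℝ) (V : 𝔼 → EReal) (C : ℝ) (x y : 𝔼) :
    shiftedKernel s V C (x, y) = shiftedKernel s V C (y, x) := by
  simp only [shiftedKernel]
  rw [← neg_sub y x, rieszKernel_neg_arg, add_assoc (rieszKernel s (y - x)), add_comm (V x),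
    ← add_assoc]

theorem IsExternalField.lowerSemicontinuous_shiftedKernel (hV : IsExternalField s V) (C : ℝ)
    (y : 𝔼) : LowerSemicontinuous fun x => shiftedKernel s V C (x, y) := by
  have h1 : LowerSemicontinuous fun x : 𝔼 => rieszKernel s (x - y) :=
    (lowerSemicontinuous_rieszKernel s).comp (continuous_id.sub continuous_const)
  have h2 : LowerSemicontinuous fun x : 𝔼 => rieszKernel s (x - y) + V x :=
    h1.add' hV.lowerSemicontinuous fun x => EReal.continuousAt_add
      (Or.inr (hV.ne_bot x)) (Or.inl (rieszKernel_ne_bot _ _))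
  have h3 : LowerSemicontinuous fun x : 𝔼 => rieszKernel s (x - y) + V x + V y :=
    h2.add' lowerSemicontinuous_const fun x => EReal.continuousAt_add
      (Or.inr (hV.ne_bot y))
      (Or.inl (by simp [EReal.add_eq_bot_iff, rieszKernel_ne_bot, hV.ne_bot]))
  have h4 : LowerSemicontinuous fun x : 𝔼 => rieszKernel s (x - y) + V x + V y + C :=
    h3.add' lowerSemicontinuous_const fun x => EReal.continuousAt_add
      (Or.inr (EReal.coe_ne_bot C)) (Or.inr (EReal.coe_ne_top C))
  exact EReal.continuous_toENNReal.comp_lowerSemicontinuous h4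
    fun a b hab => EReal.toENNReal_le_toENNReal hab

theorem shiftedKernel_of_ne_top (hV : IsExternalField s V) (C : ℝ) {x y : 𝔼}
    (hx : V x ≠ ⊤) (hy : V y ≠ ⊤) (h : x ≠ y ∨ s < 0) :
    shiftedKernel s V C (x, y) =
      ENNReal.ofReal (regKernel s 0 (x - y) + (V x).toReal + (V y).toReal + C) := by
  have hK : rieszKernel s (x - y) = (regKernel s 0 (x - y) : ℝ) := by
    rcases h with h | h
    · exact rieszKernel_of_ne_zero s (sub_ne_zero.mpr h)
    · exact rieszKernel_of_neg h _
  simp only [shiftedKernel]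
  rw [hK, ← EReal.coe_toReal hx (hV.ne_bot x), ← EReal.coe_toReal hy (hV.ne_bot y)]
  norm_cast

theorem ne_top_of_shiftedKernel_ne_top (hV : IsExternalField s V) {C : ℝ} {x y : 𝔼}
    (h : shiftedKernel s V C (x, y) ≠ ⊤) : V x ≠ ⊤ ∧ V y ≠ ⊤ ∧ (x ≠ y ∨ s < 0) := by
  have hK := rieszKernel_ne_bot s (x - y)
  have hx := hV.ne_bot x
  have hy := hV.ne_bot y
  simp only [shiftedKernel] at h
  refine ⟨fun h1 => h ?_, fun h1 => h ?_, ?_⟩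
  · rw [h1, EReal.add_top_of_ne_bot hK, EReal.top_add_of_ne_bot hy,
      EReal.top_add_of_ne_bot (EReal.coe_ne_bot C), EReal.toENNReal_top]
  · rw [h1, EReal.add_top_of_ne_bot (by simp [EReal.add_eq_bot_iff, hK, hx]),
      EReal.top_add_of_ne_bot (EReal.coe_ne_bot C), EReal.toENNReal_top]
  · by_contra! h1
    refine h ?_
    rw [h1.1, sub_self, rieszKernel_zero_eq_top h1.2, ← h1.1, EReal.top_add_of_ne_bot hx,
      EReal.top_add_of_ne_bot hx, EReal.top_add_of_ne_bot (EReal.coe_ne_bot C),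
      EReal.toENNReal_top]

theorem IsEquilibriumMeasure.exists_ne_top {μ : Measure 𝔼}
    (hμ : IsEquilibriumMeasure s V μ) : ∃ y, V y ≠ ⊤ := by
  by_contra! h
  have := hμ.isProbabilityMeasure
  have h1 : ∀ x : 𝔼, rieszKernel s x + ⊤ = ⊤ := fun x =>
    EReal.add_top_of_ne_bot (rieszKernel_ne_bot s x)
  apply hμ.energy_ne_top
  simp [energy, extIntegral, h, h1]

theorem energy_add_coe (hV : IsExternalField s V) {C : ℝ} (hC : 0 ≤ C)
    (hVC : ∀ x y, ((-C : ℝ) : EReal) ≤ rieszKernel s (x - y) + V x + V y)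
    (ν : Measure 𝔼) [IsProbabilityMeasure ν] :
    energy s V ν + C = ((∫⁻ p, shiftedKernel s V C p ∂(ν.prod ν) : ENNReal) : EReal) :=
  extIntegral_add_coe _ hV.measurable_interaction hC fun p => hVC p.1 p.2

theorem IsEquilibriumMeasure.lintegral_shiftedKernel {μ : Measure 𝔼} (hV : IsExternalField s V)
    (hμ : IsEquilibriumMeasure s V μ) {C : ℝ} (hC : 0 ≤ C)
    (hVC : ∀ x y, ((-C : ℝ) : EReal) ≤ rieszKernel s (x - y) + V x + V y) :
    ∫⁻ p, shiftedKernel s V C p ∂(μ.prod μ) ≠ ⊤ ∧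
    ∀ ν : Measure 𝔼, IsProbabilityMeasure ν →
      ∫⁻ p, shiftedKernel s V C p ∂(μ.prod μ) ≤ ∫⁻ p, shiftedKernel s V C p ∂(ν.prod ν) := by
  have := hμ.isProbabilityMeasure
  refine ⟨fun h => ?_, fun ν hν => ?_⟩
  · have h1 := energy_add_coe hV hC hVC μ
    rw [h, EReal.coe_ennreal_top] at h1
    have h2 := EReal.add_lt_top hμ.energy_ne_top (EReal.coe_ne_top C)
    exact h2.ne h1
  · rw [← EReal.coe_ennreal_le_coe_ennreal_iff, ← energy_add_coe hV hC hVC μ,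
      ← energy_add_coe hV hC hVC ν]
    exact add_le_add_left (hμ.energy_le ν hν) _

end Energy

/-! ### The potential of the equilibrium measure and the Euler–Lagrange equation. -/

section Potential

variable {d : ℕ} {s : ℝ} {V : EuclideanSpace ℝ (Fin d) → EReal}
  {μ : Measure (EuclideanSpace ℝ (Fin d))}

local notation "𝔼" => EuclideanSpace ℝ (Fin d)

theorem toReal_shiftedKernel (hV : IsExternalField s V) {C : ℝ}
    (hVC : ∀ x y, ((-C : ℝ) : EReal) ≤ rieszKernel s (x - y) + V x + V y) {x y : 𝔼}
    (h : shiftedKernel s V C (x, y) ≠ ⊤) :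
    (shiftedKernel s V C (x, y)).toReal =
      regKernel s 0 (x - y) + (V x).toReal + (V y).toReal + C := by
  obtain ⟨hx, hy, hxy⟩ := ne_top_of_shiftedKernel_ne_top hV h
  rw [shiftedKernel_of_ne_top hV C hx hy hxy, ENNReal.toReal_ofReal]
  have h1 := hVC x y
  have hK : rieszKernel s (x - y) = (regKernel s 0 (x - y) : ℝ) := by
    rcases hxy with h | h
    · exact rieszKernel_of_ne_zero s (sub_ne_zero.mpr h)
    · exact rieszKernel_of_neg h _
  rw [hK, ← EReal.coe_toReal hx (hV.ne_bot x), ← EReal.coe_toReal hy (hV.ne_bot y)] at h1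
  norm_cast at h1
  linarith

/-- A bound uniform in `y`: dropping to the smooth kernel loses nothing from below, and the smooth
kernel is Lipschitz. -/
theorem neg_slope_mul_norm_le (hs : -1 ≤ s) {x y : 𝔼} (h : x ≠ y ∨ s < 0) :
    -(slope s * ‖x‖) ≤ regKernel s 0 (x - y) - regKernel s 1 y := by
  have h1 : regKernel s 1 (x - y) ≤ regKernel s 0 (x - y) :=
    regKernel_one_le_zero (h.imp_left sub_ne_zero.mpr)
  have h2 := (abs_le.mp (abs_regKernel_one_sub_le hs (x - y) (-y))).1
  have h3 : regKernel s 1 (-y) = regKernel s 1 y := by simp [regKernel]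
  rw [sub_neg_eq_add, sub_add_cancel, h3] at h2
  linarith

/-- On the support, the potential of the shifted kernel splits into a renormalized Riesz potential,
the external field, and a constant. -/
theorem potential_decomposition (hV : IsExternalField s V) (hs : -1 ≤ s)
    [IsProbabilityMeasure μ] {C : ℝ}
    (hVC : ∀ x y, ((-C : ℝ) : EReal) ≤ rieszKernel s (x - y) + V x + V y) {x : 𝔼}
    (hx : ∫⁻ y, shiftedKernel s V C (x, y) ∂μ ≠ ⊤) :
    V x ≠ ⊤ ∧ (∫⁻ y, shiftedKernel s V C (x, y) ∂μ).toReal =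
      ∫ y, (regKernel s 0 (x - y) - regKernel s 1 y) ∂μ + (V x).toReal +
        ∫ y, ((V y).toReal + regKernel s 1 y) ∂μ + C := by
  have hm : Measurable fun y => shiftedKernel s V C (x, y) :=
    (hV.measurable_shiftedKernel C).comp measurable_prodMk_left
  have hfin : ∀ᵐ y ∂μ, shiftedKernel s V C (x, y) ≠ ⊤ := by
    filter_upwards [ae_lt_top hm hx] with y hy using hy.ne
  have hVx : V x ≠ ⊤ := by
    obtain ⟨y, hy⟩ := hfin.exists
    exact (ne_top_of_shiftedKernel_ne_top hV hy).1
  obtain ⟨M, hM⟩ := hV.exists_le_add_regKernel hs hVx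
  set g : 𝔼 → ℝ := fun y => (shiftedKernel s V C (x, y)).toReal with hg
  set F : 𝔼 → ℝ := fun y => regKernel s 0 (x - y) - regKernel s 1 y with hF
  set u : 𝔼 → ℝ := fun y => (V y).toReal + regKernel s 1 y with hu
  have hgi : Integrable g μ := integrable_toReal_of_lintegral_ne_top hm.aemeasurable hx
  have hFm : Measurable F :=
    ((measurable_regKernel s 0).comp (measurable_const.sub measurable_id)).sub
      (measurable_regKernel s 1)
  have hum : Measurable u :=
    hV.lowerSemicontinuous.measurable.ereal_toReal.add (measurable_regKernel s 1)
  -- `F` and `u` are each bounded below and their sum is integrable up to constants, so each one is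
  -- integrable. Without the correction by `regKernel s 1` these lower bounds could fail.
  have hsum : ∀ᵐ y ∂μ, g y = F y + (V x).toReal + u y + C ∧ -(slope s * ‖x‖) ≤ F y ∧
      M ≤ u y := by
    filter_upwards [hfin] with y hy
    obtain ⟨-, hy2, hxy⟩ := ne_top_of_shiftedKernel_ne_top hV hy
    refine ⟨?_, neg_slope_mul_norm_le hs hxy, hM y hy2⟩
    rw [hg, hF, hu]
    simp only
    rw [toReal_shiftedKernel hV hVC hy]
    ring
  have hFi : Integrable F μ := by
    refine (hgi.add (integrable_const (slope s * ‖x‖ + |(V x).toReal| + |M| + |C|))).mono'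
      hFm.aestronglyMeasurable ?_
    filter_upwards [hsum] with y ⟨h1, h2, h3⟩
    have h4 : 0 ≤ g y := ENNReal.toReal_nonneg
    have h5 : 0 ≤ slope s * ‖x‖ := mul_nonneg (slope_pos s).le (norm_nonneg _)
    simp only [Pi.add_apply]
    rw [Real.norm_eq_abs, abs_le]
    constructor <;> linarith [neg_abs_le M, neg_abs_le C, neg_abs_le (V x).toReal,
      abs_nonneg M, abs_nonneg C, abs_nonneg (V x).toReal]
  have hui : Integrable u μ := by
    refine (hgi.add (integrable_const (slope s * ‖x‖ + |(V x).toReal| + |M| + |C|))).mono'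
      hum.aestronglyMeasurable ?_
    filter_upwards [hsum] with y ⟨h1, h2, h3⟩
    have h4 : 0 ≤ g y := ENNReal.toReal_nonneg
    have h5 : 0 ≤ slope s * ‖x‖ := mul_nonneg (slope_pos s).le (norm_nonneg _)
    simp only [Pi.add_apply]
    rw [Real.norm_eq_abs, abs_le]
    constructor <;> linarith [neg_abs_le M, neg_abs_le C, neg_abs_le (V x).toReal,
      abs_nonneg M, abs_nonneg C, abs_nonneg (V x).toReal]
  refine ⟨hVx, ?_⟩
  rw [← integral_toReal hm.aemeasurable (by filter_upwards [hfin] with y hy using hy.lt_top)]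
  rw [integral_congr_ae (g := fun y => F y + (V x).toReal + u y + C)
    (by filter_upwards [hsum] with y hy using hy.1)]
  rw [integral_add (by fun_prop) (by fun_prop), integral_add (by fun_prop) (by fun_prop),
    integral_add (by fun_prop) (by fun_prop)]
  simp

theorem lintegral_enorm_indicator_ball_sub (f : 𝔼 → ℝ) (r : ℝ) (x : 𝔼) :
    ∫⁻ y, (Metric.ball (0 : 𝔼) r).indicator (fun z => ‖f z‖ₑ) (x - y) =
      ∫⁻ z in Metric.ball (0 : 𝔼) r, ‖f z‖ₑ := by
  rw [lintegral_sub_left_eq_self _ x, lintegral_indicator measurableSet_ball]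

/-- Bounded sets on which `V` is bounded above have finite self-energy. -/
theorem lintegral_shiftedKernel_ne_top (hd : 1 ≤ d) (hsd : s < d) (hV : IsExternalField s V)
    (C : ℝ) {A : Set 𝔼} (hA : MeasurableSet A) {R N : ℝ} (hAR : A ⊆ Metric.ball 0 R)
    (hAN : ∀ x ∈ A, V x ≤ (N : EReal)) :
    ∫⁻ x in A, ∫⁻ y in A, shiftedKernel s V C (x, y) ≠ ⊤ := by
  have : Nonempty (Fin d) := ⟨⟨0, hd⟩⟩
  have : Nontrivial 𝔼 := by infer_instance
  have hfinA : volume A ≠ ⊤ :=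
    ne_top_of_le_ne_top measure_ball_lt_top.ne (measure_mono hAR)
  -- Differences of points of `A` stay in the ball of radius `2 * R`, so `T` bounds the kernel part
  -- of the potential uniformly in `x`.
  set T : ENNReal := ∫⁻ z in Metric.ball (0 : 𝔼) (2 * R), ‖regKernel s 0 z‖ₑ with hT
  have hTfin : T ≠ ⊤ := (integrableOn_ball_regKernel_zero hd hsd (2 * R)).2.ne
  have hin : ∀ x ∈ A, ∫⁻ y in A, shiftedKernel s V C (x, y) ≤
      T + ENNReal.ofReal (N + N + C) * volume A := by
    intro x hx
    have hVx : V x ≠ ⊤ := ne_top_of_le_ne_top (EReal.coe_ne_top N) (hAN x hx)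
    have hVx' : (V x).toReal ≤ N := by
      rw [← EReal.toReal_coe N]
      exact EReal.toReal_le_toReal (hAN x hx) (hV.ne_bot x) (EReal.coe_ne_top N)
    calc ∫⁻ y in A, shiftedKernel s V C (x, y)
        ≤ ∫⁻ y in A, ((Metric.ball (0 : 𝔼) (2 * R)).indicator
            (fun z => ‖regKernel s 0 z‖ₑ) (x - y) + ENNReal.ofReal (N + N + C)) := by
          refine lintegral_mono_ae ?_
          have hne : ∀ᵐ y ∂(volume.restrict A), y ≠ x :=
            ae_restrict_of_ae (by simp [ae_iff])
          filter_upwards [ae_restrict_mem hA, hne] with y hy hyx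
          have hVy : V y ≠ ⊤ := ne_top_of_le_ne_top (EReal.coe_ne_top N) (hAN y hy)
          have hVy' : (V y).toReal ≤ N := by
            rw [← EReal.toReal_coe N]
            exact EReal.toReal_le_toReal (hAN y hy) (hV.ne_bot y) (EReal.coe_ne_top N)
          have hmem : x - y ∈ Metric.ball (0 : 𝔼) (2 * R) := by
            have h1 := mem_ball_zero_iff.mp (hAR hx)
            have h2 := mem_ball_zero_iff.mp (hAR hy)
            exact mem_ball_zero_iff.mpr ((norm_sub_le x y).trans_lt (by linarith))
          rw [shiftedKernel_of_ne_top hV C hVx hVy (Or.inl hyx.symm),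
            Set.indicator_of_mem hmem, Real.enorm_eq_ofReal_abs]
          refine le_trans (ENNReal.ofReal_le_ofReal ?_) ENNReal.ofReal_add_le
          linarith [le_abs_self (regKernel s 0 (x - y))]
      _ = (∫⁻ y in A, (Metric.ball (0 : 𝔼) (2 * R)).indicator
            (fun z => ‖regKernel s 0 z‖ₑ) (x - y)) + ENNReal.ofReal (N + N + C) * volume A := by
          rw [lintegral_add_right _ measurable_const, setLIntegral_const]
      _ ≤ _ := by
          gcongr
          rw [hT, ← lintegral_enorm_indicator_ball_sub _ _ x]
          exact setLIntegral_le_lintegral _ _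
  refine ne_top_of_le_ne_top ?_ (setLIntegral_mono measurable_const hin)
  rw [setLIntegral_const]
  finiteness

/-- The set where `P < E` and `V < ∞` is exhausted by bounded pieces on which `V` is bounded above.
Each has finite Lebesgue self-energy, by local integrability of the kernel, and so must be null. -/
theorem ae_energy_le_potential (hd : 1 ≤ d) (hsd : s < d) (hV : IsExternalField s V)
    [IsProbabilityMeasure μ] {C : ℝ}
    (hfin : ∫⁻ p, shiftedKernel s V C p ∂(μ.prod μ) ≠ ⊤)
    (hmin : ∀ ν : Measure 𝔼, IsProbabilityMeasure ν →
      ∫⁻ p, shiftedKernel s V C p ∂(μ.prod μ) ≤ ∫⁻ p, shiftedKernel s V C p ∂(ν.prod ν)) :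
    ∀ᵐ x : 𝔼, V x ≠ ⊤ →
      ∫⁻ p, shiftedKernel s V C p ∂(μ.prod μ) ≤ ∫⁻ y, shiftedKernel s V C (x, y) ∂μ := by
  have hκ := hV.measurable_shiftedKernel C
  have hP : Measurable fun x => ∫⁻ y, shiftedKernel s V C (x, y) ∂μ := hκ.lintegral_prod_right'
  set E := ∫⁻ p, shiftedKernel s V C p ∂(μ.prod μ) with hE
  have hVm : Measurable V := hV.lowerSemicontinuous.measurable
  let A : ℕ → Set 𝔼 := fun k => {x | ∫⁻ y, shiftedKernel s V C (x, y) ∂μ < E} ∩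
    ({x | V x ≤ ((k : ℝ) : EReal)} ∩ Metric.ball 0 k)
  have hA : ∀ k, volume (A k) = 0 := by
    intro k
    have hAm : MeasurableSet (A k) := (measurableSet_lt hP measurable_const).inter
      ((measurableSet_le hVm measurable_const).inter measurableSet_ball)
    have hsub : A k ⊆ Metric.ball 0 k := fun x hx => hx.2.2
    exact measure_eq_zero_of_potential_lt hκ (shiftedKernel_symm s V C) hfin hmin hAm
      (ne_top_of_le_ne_top measure_ball_lt_top.ne (measure_mono hsub))
      (lintegral_shiftedKernel_ne_top hd hsd hV C hAm hsub fun x hx => hx.2.1)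
      fun x hx => hx.1
  have hnull : ∀ᵐ x : 𝔼, ∀ k, x ∉ A k :=
    ae_all_iff.mpr fun k => measure_eq_zero_iff_ae_notMem.mp (hA k)
  filter_upwards [hnull] with x hx hVx
  by_contra! hlt
  obtain ⟨k, hk⟩ := exists_nat_gt (max (V x).toReal ‖x‖)
  refine hx k ⟨hlt, ?_, ?_⟩
  · change V x ≤ ((k : ℝ) : EReal)
    rw [← EReal.coe_toReal hVx (hV.ne_bot x)]
    exact EReal.coe_le_coe_iff.mpr ((le_max_left _ _).trans hk.le)
  · exact mem_ball_zero_iff.mpr ((le_max_right _ _).trans_lt hk)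

/-- The integrand is `D (x - y)` plus a difference of smooth kernels. The latter is at most `slope s
* R` by the Lipschitz bound; `D` is integrable on the unit ball and bounded outside it, uniformly in
`y`. This justifies Fubini below. -/
theorem integrable_renormalized_kernel (hd : 1 ≤ d) (hs : -1 ≤ s) (hsd : s < d)
    [IsProbabilityMeasure μ] (R : ℝ) :
    Integrable (fun p : 𝔼 × 𝔼 => regKernel s 0 (p.1 - p.2) - regKernel s 1 p.2)
      ((volume.restrict (Metric.ball 0 R)).prod μ) := by
  have hsl := slope_pos s
  have hFm : Measurable fun p : 𝔼 × 𝔼 => regKernel s 0 (p.1 - p.2) - regKernel s 1 p.2 :=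
    ((measurable_regKernel s 0).comp (measurable_fst.sub measurable_snd)).sub
      ((measurable_regKernel s 1).comp measurable_snd)
  refine ⟨hFm.aestronglyMeasurable, ?_⟩
  set D : 𝔼 → ℝ := fun z => regKernel s 0 z - regKernel s 1 z with hD
  have hDi : IntegrableOn D (Metric.ball 0 1) :=
    (integrableOn_ball_regKernel_zero hd hsd 1).sub
      (((contDiff_regKernel s one_pos (m := 0)).continuous.locallyIntegrable).integrableOn_isCompact
        (isCompact_closedBall 0 1) |>.mono_set Metric.ball_subset_closedBall)
  set T := ∫⁻ z in Metric.ball (0 : 𝔼) 1, ‖D z‖ₑ with hT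
  set K := ENNReal.ofReal (slope s / 2 + slope s * R) with hK
  have hT' : T ≠ ⊤ := hDi.2.ne
  have hpt : ∀ y x : 𝔼, x ∈ Metric.ball (0 : 𝔼) R →
      ‖regKernel s 0 (x - y) - regKernel s 1 y‖ₑ ≤
        (Metric.ball (0 : 𝔼) 1).indicator (fun z => ‖D z‖ₑ) (x - y) + K := by
    intro y x hx
    have hxR := mem_ball_zero_iff.mp hx
    have h2 := abs_regKernel_one_sub_le hs (x - y) (-y)
    have h3 : regKernel s 1 (-y) = regKernel s 1 y := by simp [regKernel]
    rw [sub_neg_eq_add, sub_add_cancel, h3] at h2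
    have h4 : slope s * ‖x‖ ≤ slope s * R := mul_le_mul_of_nonneg_left hxR.le hsl.le
    have h5 : |regKernel s 0 (x - y) - regKernel s 1 y| ≤ |D (x - y)| + slope s * R := by
      have : regKernel s 0 (x - y) - regKernel s 1 y =
          D (x - y) + (regKernel s 1 (x - y) - regKernel s 1 y) := by simp [hD]
      rw [this]
      exact (abs_add_le _ _).trans (by linarith)
    have h6 : 0 ≤ slope s * R := (mul_nonneg hsl.le (norm_nonneg x)).trans h4
    rw [Real.enorm_eq_ofReal_abs]
    by_cases hz : x - y ∈ Metric.ball (0 : 𝔼) 1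
    · rw [Set.indicator_of_mem hz, Real.enorm_eq_ofReal_abs]
      refine le_trans (ENNReal.ofReal_le_ofReal ?_) (ENNReal.ofReal_add (abs_nonneg _)
        (by positivity)).le
      linarith
    · rw [Set.indicator_of_notMem hz, zero_add]
      refine ENNReal.ofReal_le_ofReal (h5.trans ?_)
      rw [mem_ball_zero_iff, not_lt] at hz
      have hz0 : x - y ≠ 0 := fun h => by rw [h, norm_zero] at hz; linarith
      have h7 := regKernel_zero_le_of_one_le_norm (by linarith : -2 < s) hz
      have h8 := regKernel_one_le_zero (s := s) (Or.inl hz0)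
      have h9 : |D (x - y)| ≤ slope s / 2 := abs_le.mpr ⟨by simp only [hD]; linarith,
        by simp only [hD]; linarith⟩
      linarith
  rw [hasFiniteIntegral_iff_enorm, lintegral_prod_symm _ hFm.enorm.aemeasurable]
  have hin : ∀ y : 𝔼, ∫⁻ x in Metric.ball 0 R, ‖regKernel s 0 (x - y) - regKernel s 1 y‖ₑ ≤
      T + K * volume (Metric.ball (0 : 𝔼) R) := by
    intro y
    calc _ ≤ ∫⁻ x in Metric.ball (0 : 𝔼) R,
          ((Metric.ball (0 : 𝔼) 1).indicator (fun z => ‖D z‖ₑ) (x - y) + K) :=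
          setLIntegral_mono' measurableSet_ball fun x hx => hpt y x hx
      _ = (∫⁻ x in Metric.ball (0 : 𝔼) R,
          (Metric.ball (0 : 𝔼) 1).indicator (fun z => ‖D z‖ₑ) (x - y)) +
            K * volume (Metric.ball (0 : 𝔼) R) := by
          rw [lintegral_add_right _ measurable_const, setLIntegral_const]
      _ ≤ _ := by
          gcongr
          refine (setLIntegral_le_lintegral _ _).trans ?_
          rw [lintegral_sub_right_eq_self (fun z => (Metric.ball (0 : 𝔼) 1).indicator
            (fun z => ‖D z‖ₑ) z) y, lintegral_indicator measurableSet_ball]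
  refine (lintegral_mono hin).trans_lt ?_
  rw [lintegral_const, measure_univ, mul_one]
  have : volume (Metric.ball (0 : 𝔼) R) ≠ ⊤ := measure_ball_lt_top.ne
  finiteness

/-- Euler-Lagrange equation: on the interior of the support, the external field equals a constant
minus the renormalized Riesz potential of the equilibrium measure. -/
theorem IsEquilibriumMeasure.exists_external_field_eq (hd : 1 ≤ d) (hs : -1 ≤ s) (hsd : s < d)
    (hV : IsExternalField s V) (hμ : IsEquilibriumMeasure s V μ) :
    (∀ x ∈ μ.support, V x ≠ ⊤) ∧ ∃ c : ℝ, ∀ᵐ x : 𝔼, x ∈ μ.support →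
      (V x).toReal = c - ∫ y, (regKernel s 0 (x - y) - regKernel s 1 y) ∂μ := by
  have hprob := hμ.isProbabilityMeasure
  obtain ⟨y₀, hy₀⟩ := hμ.exists_ne_top
  obtain ⟨C, hC, hVC⟩ := hV.exists_neg_le hs hy₀
  obtain ⟨hfin, hmin⟩ := hμ.lintegral_shiftedKernel hV hC hVC
  have hκ := hV.measurable_shiftedKernel C
  have hae := potential_ae_eq_energy hκ (shiftedKernel_symm s V C) hfin hmin
  have hsupp : ∀ x ∈ μ.support, ∫⁻ y, shiftedKernel s V C (x, y) ∂μ ≤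
      ∫⁻ p, shiftedKernel s V C p ∂(μ.prod μ) := fun x hx =>
    potential_le_of_mem_support hκ (hV.lowerSemicontinuous_shiftedKernel C)
      (by filter_upwards [hae] with x hx using hx.le) hx
  have hdec := fun x (hx : x ∈ μ.support) =>
    potential_decomposition hV hs hVC (ne_top_of_le_ne_top hfin (hsupp x hx))
  refine ⟨fun x hx => (hdec x hx).1, (∫⁻ p, shiftedKernel s V C p ∂(μ.prod μ)).toReal -
    ∫ y, ((V y).toReal + regKernel s 1 y) ∂μ - C, ?_⟩
  filter_upwards [ae_energy_le_potential hd hsd hV hfin hmin] with x hx hxs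
  obtain ⟨h1, h2⟩ := hdec x hxs
  -- Both inequalities meet here: `P ≤ E` at every point of the support, `P ≥ E` at almost every
  -- point where `V` is finite.
  rw [le_antisymm (hsupp x hxs) (hx h1)] at h2
  linarith

/-! ### Distributional formula and positivity of the density. -/

theorem locallyIntegrableOn_of_ae_eq_potential (hd : 1 ≤ d) (hs : -1 ≤ s) (hsd : s < d)
    [IsProbabilityMeasure μ] {Ω : Set 𝔼} (hΩ : IsOpen Ω) {v : 𝔼 → ℝ} {c : ℝ}
    (hv : ∀ᵐ x : 𝔼, x ∈ Ω →
      v x = c - ∫ y, (regKernel s 0 (x - y) - regKernel s 1 y) ∂μ) :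
    LocallyIntegrableOn v Ω := by
  intro x hx
  refine ⟨Ω ∩ Metric.ball 0 (‖x‖ + 1), inter_mem_nhdsWithin _
    (Metric.isOpen_ball.mem_nhds (by simp)), ?_⟩
  have h1 : IntegrableOn (fun x => c - ∫ y, (regKernel s 0 (x - y) - regKernel s 1 y) ∂μ)
      (Metric.ball (0 : 𝔼) (‖x‖ + 1)) :=
    (integrableOn_const measure_ball_lt_top.ne).sub
      (integrable_renormalized_kernel hd hs hsd (‖x‖ + 1)).integral_prod_left
  refine (h1.mono_set Set.inter_subset_right).congr ?_
  filter_upwards [ae_restrict_of_ae hv,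
    ae_restrict_mem (hΩ.measurableSet.inter measurableSet_ball)] with z hz hz2
  exact (hz hz2.1).symm

/-- Fubini reduces the claim to testing `K_s(· - y)` against `Δ^n φ` for fixed `y`, where the
fundamental solution returns `φ y`. -/
theorem integral_mul_iterLaplacian_of_ae_eq_potential {n : ℕ} (hn : 1 ≤ n) (hd : 1 ≤ d)
    (hsdn : s = (d : ℝ) - 2 * (n : ℕ)) (hs : -1 ≤ s) (hsd : s < d)
    [IsProbabilityMeasure μ] {Ω : Set 𝔼} {v : 𝔼 → ℝ} {c : ℝ}
    (hv : ∀ᵐ x : 𝔼, x ∈ Ω →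
      v x = c - ∫ y, (regKernel s 0 (x - y) - regKernel s 1 y) ∂μ)
    {φ : 𝔼 → ℝ} (hφ : ContDiff ℝ (⊤ : ℕ∞) φ) (hφc : HasCompactSupport φ)
    (hφΩ : tsupport φ ⊆ Ω) :
    ∫ x, v x * iterLaplacian n φ x =
      (coulombConst d * iterCoulombConst d n) * ∫ x, φ x ∂μ := by
  set ψ := iterLaplacian n φ with hψ
  have hψs : ContDiff ℝ (⊤ : ℕ∞) ψ := contDiff_top_iterLaplacian n hφ
  have hψcont : Continuous ψ := hψs.continuous
  have hψc : HasCompactSupport ψ := hasCompactSupport_iterLaplacian n hφc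
  -- As `n ≥ 1`, `ψ` is itself a Laplacian. Its zero mean removes both the constant `c` and the
  -- correction `regKernel s 1 y`, which is constant in `x`.
  have hψ0 : ∫ x, ψ x = 0 := by
    obtain ⟨m, rfl⟩ : ∃ m, n = m + 1 := ⟨n - 1, by omega⟩
    rw [hψ, iterLaplacian_succ']
    exact integral_laplacian_eq_zero (contDiff_infty.1 (contDiff_top_iterLaplacian m hφ) 2)
      (hasCompactSupport_iterLaplacian m hφc)
  have hψi : Integrable ψ := hψcont.integrable_of_hasCompactSupport hψc
  obtain ⟨R, hR⟩ := hψc.isBounded.subset_ball (0 : 𝔼)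
  have hout : ∀ x, x ∉ Metric.ball (0 : 𝔼) R → ψ x = 0 := fun x hx =>
    image_eq_zero_of_notMem_tsupport fun h => hx (hR h)
  set F : 𝔼 × 𝔼 → ℝ := fun p => regKernel s 0 (p.1 - p.2) - regKernel s 1 p.2 with hF
  have hFi : Integrable F ((volume.restrict (Metric.ball 0 R)).prod μ) :=
    integrable_renormalized_kernel hd hs hsd R
  obtain ⟨B, hB⟩ := hψcont.bounded_above_of_compact_support hψc
  have hFψ : Integrable (fun p : 𝔼 × 𝔼 => F p * ψ p.1)
      ((volume.restrict (Metric.ball 0 R)).prod μ) :=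
    hFi.mul_bdd (c := B) (hψcont.comp continuous_fst).aestronglyMeasurable
      (ae_of_all _ fun p => hB p.1)
  have hWi : IntegrableOn (fun x => (∫ y, F (x, y) ∂μ) * ψ x) (Metric.ball 0 R) := by
    have h := hFψ.integral_prod_left
    simp only [integral_mul_const] at h
    exact h
  have hWi' : Integrable (fun x => (∫ y, F (x, y) ∂μ) * ψ x) :=
    (integrableOn_iff_integrable_of_support_subset fun x hx => by
      by_contra hxb
      exact hx (by simp [hout x hxb])).mp hWi
  have h1 : ∫ x, v x * ψ x = ∫ x, (c * ψ x - (∫ y, F (x, y) ∂μ) * ψ x) := by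
    refine integral_congr_ae ?_
    filter_upwards [hv] with x hx
    by_cases hxΩ : x ∈ Ω
    · rw [hx hxΩ, sub_mul]
    · have : ψ x = 0 := image_eq_zero_of_notMem_tsupport fun h =>
        hxΩ (hφΩ (tsupport_iterLaplacian_subset n φ h))
      simp [this]
  have h2 : ∫ x, (∫ y, F (x, y) ∂μ) * ψ x = ∫ y, (∫ x, F (x, y) * ψ x) ∂μ := by
    rw [← setIntegral_eq_integral_of_forall_compl_eq_zero (s := Metric.ball (0 : 𝔼) R)
      fun x hx => by simp [hout x hx]]
    simp only [← integral_mul_const]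
    rw [integral_integral_swap (f := fun x y => F (x, y) * ψ x) hFψ]
    congr 1
    funext y
    exact setIntegral_eq_integral_of_forall_compl_eq_zero fun x hx => by simp [hout x hx]
  have h3 : ∀ y, ∫ x, F (x, y) * ψ x = -(coulombConst d * iterCoulombConst d n) * φ y := by
    intro y
    have hloc : LocallyIntegrable fun x : 𝔼 => regKernel s 0 (x - y) := by
      intro x
      obtain ⟨U, hU, hUi⟩ := locallyIntegrable_regKernel_zero hd hsd (x - y)
      refine ⟨(fun x => x - y) ⁻¹' U, (continuous_id.sub continuous_const).continuousAt hU, ?_⟩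
      exact ((measurePreserving_sub_right volume y).integrableOn_comp_preimage
        (MeasurableEquiv.subRight y).measurableEmbedding).mpr hUi
    have hi : Integrable fun x => regKernel s 0 (x - y) * ψ x :=
      hloc.integrable_smul_right_of_hasCompactSupport hψcont hψc
    simp only [hF, sub_mul]
    rw [integral_sub hi (hψi.const_mul _), integral_const_mul, hψ0, mul_zero, sub_zero]
    exact integral_regKernel_sub_mul_iterLaplacian hn hd hsdn (by linarith) hφ hφc y
  rw [h1, integral_sub (hψi.const_mul c) hWi', integral_const_mul, hψ0, h2]
  simp only [h3]
  rw [integral_const_mul]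
  ring

theorem coulombConst_pos (hd : 1 ≤ d) : 0 < coulombConst d := by
  have hd0 : (0 : ℝ) < d := by exact_mod_cast hd
  have hG : 0 < Real.Gamma ((d : ℝ) / 2 + 1) := Real.Gamma_pos_of_pos (by positivity)
  have := slope_pos ((d : ℝ) - 2)
  rw [coulombConst_eq hd]
  positivity

/-- If `∫ φ dμ = a ∫ g φ` for all test functions `φ` on an open set, with `μ` a positive measure and
`g` continuous, then `a g ≥ 0` on that set. -/
theorem nonneg_of_forall_integral_eq {Ω : TopologicalSpace.Opens 𝔼} {g : 𝔼 → ℝ}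
    (hg : Continuous g) {a : ℝ}
    (h : ∀ φ : 𝓓(Ω, ℝ), a * ∫ x, g x * φ x = ∫ x, φ x ∂μ) {x : 𝔼} (hx : x ∈ Ω) :
    0 ≤ a * g x := by
  by_contra! hlt
  have hU : {y | a * g y < 0} ∩ (Ω : Set 𝔼) ∈ nhds x :=
    Filter.inter_mem ((isOpen_lt (by fun_prop) continuous_const).mem_nhds hlt) (Ω.isOpen.mem_nhds hx)
  obtain ⟨r, hr, hrU⟩ := Metric.nhds_basis_closedBall.mem_iff.mp hU
  -- The bump lives in a ball inside `Ω` where `a * g < 0`, so one side of `h` is negative and the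
  -- other is not.
  let b : ContDiffBump x := ⟨r / 2, r, by positivity, by linarith⟩
  have hts : tsupport b = Metric.closedBall x r := b.tsupport_eq
  let φ : 𝓓(Ω, ℝ) := ⟨b, b.contDiff, b.hasCompactSupport, by
    rw [hts]; exact fun y hy => (hrU hy).2⟩
  have hφb : ∀ y, φ y = b y := fun y => rfl
  have h1 := h φ
  simp only [hφb] at h1
  have h2 : 0 ≤ ∫ y, b y ∂μ := integral_nonneg fun y => b.nonneg
  have h3 : 0 < ∫ y, -(a * g y) * b y := by
    refine Continuous.integral_pos_of_hasCompactSupport_nonneg_nonzero (x := x)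
      (by have := b.continuous; fun_prop) b.hasCompactSupport.mul_left (fun y => ?_) ?_
    · by_cases hy : y ∈ Metric.closedBall x r
      · have : a * g y < 0 := (hrU hy).1
        exact mul_nonneg (by linarith) b.nonneg
      · rw [← hts] at hy
        simp [image_eq_zero_of_notMem_tsupport hy]
    · have : b x = 1 := b.one_of_mem_closedBall (by simp [b]; positivity)
      rw [this, mul_one]
      linarith
  have h4 : ∫ y, -(a * g y) * b y = -(a * ∫ y, g y * b y) := by
    rw [← integral_const_mul, ← integral_neg]
    congr 1; funext y; ring
  rw [h4, h1] at h3
  linarith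

end Potential

end RieszGas

end

/-! ### The main theorem. -/

theorem proposition2p1 (d n : ℕ) (hn : 1 ≤ n) (s : ℝ) (hsd : s = (d : ℝ) - 2 * (n : ℝ))
    (hs : -2 < s) (V : EuclideanSpace ℝ (Fin d) → EReal) (hV : RieszGas.IsExternalField s V)
    (μ : Measure (EuclideanSpace ℝ (Fin d))) (hμ : RieszGas.IsEquilibriumMeasure s V μ) :
    ((∀ᵐ x ∂(volume.restrict (interior μ.support)), V x ≠ ⊤) ∧
      LocallyIntegrableOn (fun x => (V x).toReal) (interior μ.support) volume ∧
      ∀ φ : 𝓓(RieszGas.suppInterior μ, ℝ),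
        ∫ x, φ x ∂μ =
          (∫ x, (V x).toReal * RieszGas.iterLaplacian n (fun y => φ y) x) /
            (RieszGas.coulombConst d * RieszGas.iterCoulombConst d n)) ∧
    (Odd n → 0 < RieszGas.iterCoulombConst d n ∧
      ∀ W : EuclideanSpace ℝ (Fin d) → ℝ, ContDiff ℝ (2 * n : ℕ) W →
        (∀ x, V x = (W x : EReal)) →
        interior μ.support ∩ {x | RieszGas.iterLaplacian n W x < 0} = ∅) ∧
    (Even n → RieszGas.iterCoulombConst d n < 0 ∧
      ∀ W : EuclideanSpace ℝ (Fin d) → ℝ, ContDiff ℝ (2 * n : ℕ) W →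
        (∀ x, V x = (W x : EReal)) →
        interior μ.support ∩ {x | 0 < RieszGas.iterLaplacian n W x} = ∅) := by
  have hn0 : (1 : ℝ) ≤ n := by exact_mod_cast hn
  -- `s` is an integer, so `s > -2` improves to `s ≥ -1`, the range of the Lipschitz estimate.
  have hs1 : -1 ≤ s := by
    have h : (-2 : ℤ) < d - 2 * n := by
      have : ((-2 : ℤ) : ℝ) < ((d - 2 * n : ℤ) : ℝ) := by push_cast; linarith
      exact_mod_cast this
    have h' : (-1 : ℤ) ≤ d - 2 * n := by omega
    have : ((-1 : ℤ) : ℝ) ≤ ((d - 2 * n : ℤ) : ℝ) := by exact_mod_cast h'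
    push_cast at this
    linarith
  have hd : 1 ≤ d := by
    have : (0 : ℝ) < d := by linarith
    exact_mod_cast this
  have hsd' : s < d := by linarith
  have hprob := hμ.isProbabilityMeasure
  obtain ⟨hfin, c, hc⟩ := hμ.exists_external_field_eq hd hs1 hsd' hV
  have hcΩ : ∀ᵐ x, x ∈ interior μ.support → (V x).toReal = c -
      ∫ y, (RieszGas.regKernel s 0 (x - y) - RieszGas.regKernel s 1 y) ∂μ := by
    filter_upwards [hc] with x hx hxΩ using hx (interior_subset hxΩ)
  have hsign := RieszGas.sign_iterCoulombConst d (n := n)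
  have hcd := RieszGas.coulombConst_pos hd
  have hC0 : RieszGas.iterCoulombConst d n ≠ 0 := by
    intro h; rw [h, mul_zero] at hsign; exact hsign.false
  have hformula : ∀ φ : 𝓓(RieszGas.suppInterior μ, ℝ), ∫ x, φ x ∂μ =
      (∫ x, (V x).toReal * RieszGas.iterLaplacian n (fun y => φ y) x) /
        (RieszGas.coulombConst d * RieszGas.iterCoulombConst d n) := by
    intro φ
    rw [eq_div_iff (mul_ne_zero hcd.ne' hC0), mul_comm]
    exact (RieszGas.integral_mul_iterLaplacian_of_ae_eq_potential hn hd hsd hs1 hsd' hcΩ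
      φ.contDiff φ.hasCompactSupport φ.tsupport_subset).symm
  have hnonneg : ∀ W : EuclideanSpace ℝ (Fin d) → ℝ, ContDiff ℝ (2 * n : ℕ) W →
      (∀ x, V x = (W x : EReal)) → ∀ x ∈ interior μ.support,
        0 ≤ (RieszGas.coulombConst d * RieszGas.iterCoulombConst d n)⁻¹ *
          RieszGas.iterLaplacian n W x := by
    intro W hW hVW x hx
    refine RieszGas.nonneg_of_forall_integral_eq (μ := μ) (Ω := RieszGas.suppInterior μ)
      (RieszGas.contDiff_iterLaplacian (m := 0) n hW).continuous (fun φ => ?_) hx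
    -- Green's identity on the whole space moves `Δ^n` from the test function to `W`, so the
    -- distributional density is the classical one.
    rw [hformula φ, ← RieszGas.integral_mul_iterLaplacian n hW φ.contDiff φ.hasCompactSupport,
      div_eq_inv_mul]
    simp only [hVW, EReal.toReal_coe]
  refine ⟨⟨?_, RieszGas.locallyIntegrableOn_of_ae_eq_potential hd hs1 hsd' isOpen_interior hcΩ,
    hformula⟩, fun hodd => ?_, fun heven => ?_⟩
  · filter_upwards [ae_restrict_mem isOpen_interior.measurableSet] with x hx
      using hfin x (interior_subset hx)
  · have hC : 0 < RieszGas.iterCoulombConst d n := by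
      have he : Even (n - 1) := hodd.tsub_odd odd_one
      simpa [he.neg_one_pow] using hsign
    refine ⟨hC, fun W hW hVW => Set.eq_empty_iff_forall_notMem.mpr fun x ⟨hx, hlt⟩ => ?_⟩
    have hlt' : RieszGas.iterLaplacian n W x < 0 := hlt
    have h1 : 0 < (RieszGas.coulombConst d * RieszGas.iterCoulombConst d n)⁻¹ :=
      inv_pos.mpr (mul_pos hcd hC)
    exact absurd (hnonneg W hW hVW x hx) (not_le.mpr (mul_neg_of_pos_of_neg h1 hlt'))
  · have hC : RieszGas.iterCoulombConst d n < 0 := by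
      have ho : Odd (n - 1) := by
        obtain ⟨k, rfl⟩ := heven
        exact ⟨k - 1, by omega⟩
      simpa [ho.neg_one_pow] using hsign
    refine ⟨hC, fun W hW hVW => Set.eq_empty_iff_forall_notMem.mpr fun x ⟨hx, hlt⟩ => ?_⟩
    have hlt' : 0 < RieszGas.iterLaplacian n W x := hlt
    have h1 : (RieszGas.coulombConst d * RieszGas.iterCoulombConst d n)⁻¹ < 0 :=
      inv_lt_zero.mpr (mul_neg_of_pos_of_neg hcd hC)
    exact absurd (hnonneg W hW hVW x hx) (not_le.mpr (mul_neg_of_neg_of_pos h1 hlt'))
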